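/- Let $\alpha\in\mathbb R\setminus\mathbb Q$ and let $R_\alpha(x)=x+\alpha$ be the rotation of $S^1=\mathbb R/\mathbb Z$. For $u,v\in S^1$ let $\ell([u,v])\in[0,1)$ be the length of the positively oriented arc from $u$ to $v$. For $n\ge 2$ let $r_n\alpha$ and $s_n\alpha$ ($1\le r_n,s_n\le n$) be the points of $\{0,\alpha,\dots,n\alpha\}$ adjacent to $0$ on the left and on the right, and put $a_n=\ell([r_n\alpha,0])$, $b_n=\ell([0,s_n\alpha])$, $I_n=(r_n\alpha,s_n\alpha)$ and $J_n=((n-s_n)\alpha,(n-r_n)\alpha)$. The wandering time $w(n)$ is the largest integer $w\ge 0$ such that the arcs $I_n,R_\alpha(I_n),\dots,R_\alpha^w(I_n),R_\alpha^{-w}(J_n),\dots,R_\alpha^{-1}(J_n),J_n$ are pairwise disjoint (it exists for all the large times $n=k_i$ considered below). A sequence of characteristic times of $\alpha$ is a sequence $k_i=N_i-1$, where $(N_i)$ is a strictly increasing sequence of integers such that, for every $i$, with $N=N_i$: $r_N+s_N=N+1$, $\frac{a_N}{b_N}\in[\frac12,2]$ (so that $N+1$ is a closest return time), and either $a_N<b_N$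 and $r_N\le 2s_N$, or $a_N>b_N$ and $s_N\le 2r_N$. Put $w_i=w(k_i)$. For an orientation preserving homeomorphism $f$ of $S^1$ without periodic points, $x\in S^1$ and $n\ge2$, let $[a,b]$ and $[c,d]$ be the arcs with end points in $\{x,f(x),\dots,f^n(x)\}$ such that $x$ is the only point of this set in the open arc $(a,b)$ and $f^n(x)$ the only one in $(c,d)$. The initial and final ratio of the orbit segment $x,\dots,f^n(x)$ are $$\frac{\ell([a,x])}{\ell([x,b])}\quad\text{and}\quad\frac{\ell([c,f^n(x)])}{\ell([f^n(x),d])}.$$ \textbf{Lemma.} Sequences of characteristic times of $\alpha$ exist. Let $(k_i)$ be any of them and let $f$ be an orientation preserving $C^1$-diffeomorphism of $S^1$ with rotation number $\alpha$ modulo $\mathbb Z$. Then for every $\lambda>1$ there is $i(\lambda)$ such that for every $i\ge i(\lambda)$ and every $x\in S^1$ the initial and final ratios of the characteristic segment $x,f(x),\dots,f^{k_i}(x)$ belong to $[\lambda^{-w_i},\lambda^{w_i}]$. -/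

import Mathlib

/-- Length of the arc of the circle `ℝ/ℤ` going from `u` to `v` in the positive direction;
it lies in `[0, 1)`. -/
noncomputable def arcLength (u v : UnitAddCircle) : ℝ :=
  (AddCircle.equivIco (1 : ℝ) 0 (v - u) : ℝ)

/-- `F¹_α`: the orientation preserving `C¹`-diffeomorphisms `f` of the circle with rotation number
`α ∈ ℝ/ℤ`. Such an `f` is the projection of an invertible lift `F : ℝ → ℝ` with
`F (t + 1) = F t + 1`, where `F` and its inverse are `C¹`; its rotation number is the class
modulo `ℤ` of the translation number of `F`. -/
def FOne (α : UnitAddCircle) : Set (UnitAddCircle → UnitAddCircle) :=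
  {f | ∃ F : CircleDeg1Liftˣ,
    ContDiff ℝ 1 (F : CircleDeg1Lift) ∧
    ContDiff ℝ 1 ((F⁻¹ : CircleDeg1Liftˣ) : CircleDeg1Lift) ∧
    (∀ t : ℝ, f (t : UnitAddCircle) = (((F : CircleDeg1Lift) t : ℝ) : UnitAddCircle)) ∧
    ((CircleDeg1Lift.translationNumber (F : CircleDeg1Lift) : ℝ) : UnitAddCircle) = α}

/-- The orbit segment `{x, f x, …, fⁿ x}`. -/
def orbitSegment (f : UnitAddCircle → UnitAddCircle) (n : ℕ) (x : UnitAddCircle) :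
    Set UnitAddCircle :=
  {y | ∃ j : ℕ, j ≤ n ∧ y = f^[j] x}

/-- `[a, b]` is the basic interval of the point `p` of `S`: its end points lie in `S`, and `p` is
the only point of `S` in the open arc from `a` to `b`. -/
def IsBasicInterval (S : Set UnitAddCircle) (p a b : UnitAddCircle) : Prop :=
  a ∈ S ∧ b ∈ S ∧ Set.cIoo a b ∩ S = {p}

/-- `ρ = ℓ([a, x]) / ℓ([x, b])`, with `[a, b]` the initial basic interval of the orbit segment
`{x, …, fⁿ x}`. -/
def IsInitialRatio (f : UnitAddCircle → UnitAddCircle) (n : ℕ) (x : UnitAddCircle) (ρ : ℝ) :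
    Prop :=
  ∃ a b : UnitAddCircle, IsBasicInterval (orbitSegment f n x) x a b ∧
    ρ = arcLength a x / arcLength x b

/-- `ρ = ℓ([c, fⁿ x]) / ℓ([fⁿ x, d])`, with `[c, d]` the final basic interval of the orbit segment
`{x, …, fⁿ x}`. -/
def IsFinalRatio (f : UnitAddCircle → UnitAddCircle) (n : ℕ) (x : UnitAddCircle) (ρ : ℝ) :
    Prop :=
  ∃ c d : UnitAddCircle, IsBasicInterval (orbitSegment f n x) (f^[n] x) c d ∧
    ρ = arcLength c (f^[n] x) / arcLength (f^[n] x) d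

/-- `r_n ∈ {1, …, n}`: the point `r_n α` precedes `0` among the points `0, α, …, nα`, that is, no
point of this orbit segment lies in the open arc from `r_n α` to `0`. (For irrational `α` and
`n ≥ 1` there is exactly one such index.) -/
noncomputable def leftTime (α : UnitAddCircle) (n : ℕ) : ℕ :=
  sInf {r : ℕ | 1 ≤ r ∧ r ≤ n ∧ ∀ j : ℕ, j ≤ n → j • α ∉ Set.cIoo (r • α) 0}

/-- `s_n ∈ {1, …, n}`: the point `s_n α` follows `0` among the points `0, α, …, nα`, that is, no
point of this orbit segment lies in the open arc from `0` to `s_n α`. (For irrational `α` and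
`n ≥ 1` there is exactly one such index.) -/
noncomputable def rightTime (α : UnitAddCircle) (n : ℕ) : ℕ :=
  sInf {s : ℕ | 1 ≤ s ∧ s ≤ n ∧ ∀ j : ℕ, j ≤ n → j • α ∉ Set.cIoo 0 (s • α)}

/-- `a_n`, the length of the arc from `r_n α` to `0`. -/
noncomputable def leftGap (α : UnitAddCircle) (n : ℕ) : ℝ := arcLength (leftTime α n • α) 0

/-- `b_n`, the length of the arc from `0` to `s_n α`. -/
noncomputable def rightGap (α : UnitAddCircle) (n : ℕ) : ℝ := arcLength 0 (rightTime α n • α)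

/-- The open arc `I_n = (r_n α, s_n α)`, which contains `0`. -/
noncomputable def arcI (α : UnitAddCircle) (n : ℕ) : Set UnitAddCircle :=
  Set.cIoo (leftTime α n • α) (rightTime α n • α)

/-- The open arc `J_n = ((n - s_n) α, (n - r_n) α)`, which contains `nα`. -/
noncomputable def arcJ (α : UnitAddCircle) (n : ℕ) : Set UnitAddCircle :=
  Set.cIoo (((n : ℤ) - rightTime α n) • α) (((n : ℤ) - leftTime α n) • α)

/-- The image of `A` under the `m`-th iterate of the rotation by `α`. -/
def rotateSet (α : UnitAddCircle) (m : ℤ) (A : Set UnitAddCircle) : Set UnitAddCircle :=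
  (fun z => z + m • α) '' A

/-- The arcs `I_n, R_α(I_n), …, R_α^w(I_n), R_α^{-w}(J_n), …, J_n` are pairwise disjoint. -/
def WandersFor (α : UnitAddCircle) (n w : ℕ) : Prop :=
  (∀ i j : ℕ, i ≤ w → j ≤ w → i ≠ j →
    Disjoint (rotateSet α i (arcI α n)) (rotateSet α j (arcI α n))) ∧
  (∀ i j : ℕ, i ≤ w → j ≤ w → i ≠ j →
    Disjoint (rotateSet α (-(i : ℤ)) (arcJ α n)) (rotateSet α (-(j : ℤ)) (arcJ α n))) ∧
  (∀ i j : ℕ, i ≤ w → j ≤ w →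
    Disjoint (rotateSet α i (arcI α n)) (rotateSet α (-(j : ℤ)) (arcJ α n)))

/-- The wandering time `w(n)`: the largest `w` for which the above arcs are pairwise disjoint. -/
noncomputable def wanderingTime (α : UnitAddCircle) (n : ℕ) : ℕ :=
  sSup {w : ℕ | WandersFor α n w}

/-- `n + 1` is a closest return time of the rotation by `α`: the point `(n + 1) α` falls into
`[-a_n, b_n]`, that is `r_n + s_n = n + 1`, and `a_n / b_n ∈ [1/2, 2]`. -/
def IsBeforeClosestReturn (α : UnitAddCircle) (n : ℕ) : Prop :=
  leftTime α n + rightTime α n = n + 1 ∧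
    leftGap α n / rightGap α n ∈ Set.Icc (1 / 2 : ℝ) 2

/-- The times `N` from which the characteristic times `N - 1` are built: `N + 1` is a closest
return time, and either `a_N < b_N` and `r_N ≤ 2 s_N`, or `a_N > b_N` and `s_N ≤ 2 r_N`. -/
def IsPreCharacteristic (α : UnitAddCircle) (N : ℕ) : Prop :=
  IsBeforeClosestReturn α N ∧
    ((leftGap α N < rightGap α N ∧ leftTime α N ≤ 2 * rightTime α N) ∨
      (rightGap α N < leftGap α N ∧ rightTime α N ≤ 2 * leftTime α N))

/-- `k` is a sequence of characteristic times of `α`: `k i = N i - 1` for a strictly increasing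
sequence `N` of times as above. -/
def IsCharacteristicSequence (α : UnitAddCircle) (k : ℕ → ℕ) : Prop :=
  ∃ N : ℕ → ℕ, StrictMono N ∧ (∀ i, IsPreCharacteristic α (N i)) ∧ ∀ i, k i = N i - 1

/-! Both ratios compare two arcs at a point `T` of the orbit, cut off by lifts `g` and `h` of
iterates of `f` that displace to the left and to the right. The orbits of `f` are ordered like those
of the rotation. If the rotation moves left by `a` under `g` and right by `b` under `h`, with `a ≤ b
≤ 2a`, then `T ≤ g (h T)` and `h T ≤ g⁻² T`. The first inequality bounds `T - g T` by the length of
the `g`-image of `[T, h T]`; the second bounds `h T - T` by the lengths of the images of `[g T, T]`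
under `g⁻¹` and `g⁻²`. So only iterates up to twice the time of the nearer neighbour distort the
ratio (`ratio_bounds_of_left_le`, `ratio_bounds_of_right_le`).

A `C¹` diffeomorphism with irrational rotation number satisfies `|Df^n| ≤ C μ^|n|` for every `μ > 1`
(`exists_abs_pow_sub_le`). The ratios are therefore subexponential in the time of the nearer
neighbour. For a characteristic time this time is at most `2 min (r, s)`, and `min (r, s) ≤ 2 w + 4`
since translates of `I_n` by fewer than `min (r, s)` steps are disjoint
(`min_time_le_wanderingTime`). As `w` tends to infinity, a suitable power of `μ` absorbs `C`.

Characteristic times come from the subtractive Euclidean algorithm on Farey pairs around `α`: a pair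
with balanced gaps but unbalanced times becomes good after switching to the other side
(`exists_balanced_of_lt`). -/

/-! ### Arcs of the circle in real coordinates -/

theorem UnitAddCircle.coe_eq_coe_iff {x y : ℝ} :
    (x : UnitAddCircle) = y ↔ ∃ m : ℤ, x + m = y := by
  rw [eq_comm, ← sub_eq_zero, ← AddCircle.coe_sub, AddCircle.coe_eq_zero_iff]
  constructor
  · rintro ⟨m, hm⟩
    refine ⟨m, ?_⟩
    simp at hm
    linarith
  · rintro ⟨m, hm⟩
    refine ⟨m, ?_⟩
    simp
    linarith

theorem UnitAddCircle.coe_add_intCast (x : ℝ) (m : ℤ) :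
    ((x + m : ℝ) : UnitAddCircle) = x :=
  (coe_eq_coe_iff.2 ⟨m, rfl⟩).symm

theorem UnitAddCircle.natCast_smul_coe (n : ℕ) (x : ℝ) :
    n • (x : UnitAddCircle) = ((n * x : ℝ) : UnitAddCircle) := by
  rw [← nsmul_eq_mul, AddCircle.coe_nsmul]

theorem UnitAddCircle.intCast_smul_coe (n : ℤ) (x : ℝ) :
    n • (x : UnitAddCircle) = ((n * x : ℝ) : UnitAddCircle) := by
  rw [← zsmul_eq_mul, AddCircle.coe_zsmul]

theorem coe_mem_cIoo_iff {u v z : ℝ} (h₁ : u < v) (h₂ : v < u + 1) :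
    (z : UnitAddCircle) ∈ Set.cIoo (u : UnitAddCircle) (v : UnitAddCircle) ↔
      ∃ m : ℤ, u < z + m ∧ z + m < v := by
  have hmem : (z : UnitAddCircle) ∈ Set.cIoo (u : UnitAddCircle) (v : UnitAddCircle) ↔
      toIocMod one_pos u z < v := by
    change sbtw (u : UnitAddCircle) (z : UnitAddCircle) (v : UnitAddCircle) ↔ _
    rw [sbtw_iff_not_btw, btw_cyclic]
    have hv : toIcoMod (one_pos : (0 : ℝ) < 1) u v = v :=
      (toIcoMod_eq_self one_pos).2 ⟨h₁.le, h₂⟩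
    have := @QuotientAddGroup.btw_coe_iff ℝ _ _ _ _ 1 _ u v z
    rw [hv] at this
    exact (not_congr this).trans not_le
  rw [hmem]
  constructor
  · intro h
    refine ⟨-toIocDiv one_pos u z, ?_⟩
    have h3 := left_lt_toIocMod (one_pos : (0 : ℝ) < 1) u z
    have h4 := toIocMod_add_toIocDiv_zsmul (one_pos : (0 : ℝ) < 1) u z
    simp only [zsmul_eq_mul, mul_one] at h4
    push_cast
    constructor <;> linarith
  · rintro ⟨m, hm₁, hm₂⟩
    have : toIocMod (one_pos : (0 : ℝ) < 1) u z = z + m := by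
      rw [toIocMod_eq_iff]
      refine ⟨⟨hm₁, by linarith⟩, -m, ?_⟩
      simp
    rwa [this]

theorem arcLength_coe (u v : ℝ) :
    arcLength (u : UnitAddCircle) (v : UnitAddCircle) = Int.fract (v - u) := by
  rw [arcLength, ← AddCircle.coe_sub, AddCircle.coe_equivIco_mk_apply]
  simp

theorem arcLength_coe_eq {u v d : ℝ} (m : ℤ) (h : d = v - u + m) (h₀ : 0 ≤ d) (h₁ : d < 1) :
    arcLength (u : UnitAddCircle) (v : UnitAddCircle) = d := by
  rw [arcLength_coe, Int.fract_eq_iff]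
  exact ⟨h₀, h₁, -m, by rw [h]; push_cast; ring⟩

theorem mem_rotateSet_cIoo_iff {τ c d : ℝ} (h₁ : c < d) (h₂ : d < c + 1) (k : ℤ) (z : ℝ) :
    (z : UnitAddCircle) ∈ rotateSet (τ : UnitAddCircle) k (Set.cIoo (c : UnitAddCircle) d) ↔
      ∃ m : ℤ, c < z - k * τ + m ∧ z - k * τ + m < d := by
  rw [← coe_mem_cIoo_iff h₁ h₂, rotateSet, Set.image_add_right, Set.mem_preimage,
    UnitAddCircle.intCast_smul_coe, AddCircle.coe_sub, sub_eq_add_neg]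

/-! ### Neighbours of zero in an orbit segment of the rotation -/

/-- `r ∈ {1, …, n}` is the time of the left neighbour of `0` among `0, τ, …, nτ` modulo `1`, at
distance `a`. -/
structure IsLeftNeighbour (τ : ℝ) (n r : ℕ) (a : ℝ) : Prop where
  one_le : 1 ≤ r
  le : r ≤ n
  pos : 0 < a
  lt_one : a < 1
  exists_eq : ∃ p : ℤ, a = p - r * τ
  not_between : ∀ j : ℕ, j ≤ n → ∀ m : ℤ, ¬(-a < j * τ + m ∧ j * τ + m < 0)

/-- `s ∈ {1, …, n}` is the time of the right neighbour of `0` among `0, τ, …, nτ` modulo `1`, at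
distance `b`. -/
structure IsRightNeighbour (τ : ℝ) (n s : ℕ) (b : ℝ) : Prop where
  one_le : 1 ≤ s
  le : s ≤ n
  pos : 0 < b
  lt_one : b < 1
  exists_eq : ∃ p : ℤ, b = s * τ - p
  not_between : ∀ j : ℕ, j ≤ n → ∀ m : ℤ, ¬(0 < j * τ + m ∧ j * τ + m < b)

theorem Irrational.eq_zero_of_mul_add_eq_zero {τ : ℝ} (hτ : Irrational τ) {j : ℤ} {m : ℤ}
    (h : j * τ + m = 0) : j = 0 := by
  by_contra hj
  have := (hτ.intCast_mul hj).add_intCast m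
  rw [h] at this
  exact not_irrational_zero this

theorem leftSet_iff {τ : ℝ} {n r : ℕ} {a : ℝ} {p : ℤ} (hp : a = p - r * τ) (h₀ : 0 < a)
    (h₁ : a < 1) : (∀ j : ℕ, j ≤ n →
      j • (τ : UnitAddCircle) ∉ Set.cIoo (r • (τ : UnitAddCircle)) 0) ↔
      ∀ j : ℕ, j ≤ n → ∀ m : ℤ, ¬(-a < j * τ + m ∧ j * τ + m < 0) := by
  have hr : r • (τ : UnitAddCircle) = ((-a : ℝ) : UnitAddCircle) := by
    rw [UnitAddCircle.natCast_smul_coe, UnitAddCircle.coe_eq_coe_iff]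
    exact ⟨-p, by rw [hp]; push_cast; ring⟩
  have h0 : (0 : UnitAddCircle) = ((0 : ℝ) : UnitAddCircle) := rfl
  simp only [hr, h0, UnitAddCircle.natCast_smul_coe]
  refine forall₂_congr fun j _ => ?_
  rw [coe_mem_cIoo_iff (by linarith) (by linarith), not_exists]

theorem rightSet_iff {τ : ℝ} {n s : ℕ} {b : ℝ} {p : ℤ} (hp : b = s * τ - p) (h₀ : 0 < b)
    (h₁ : b < 1) : (∀ j : ℕ, j ≤ n →
      j • (τ : UnitAddCircle) ∉ Set.cIoo 0 (s • (τ : UnitAddCircle))) ↔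
      ∀ j : ℕ, j ≤ n → ∀ m : ℤ, ¬(0 < j * τ + m ∧ j * τ + m < b) := by
  have hr : s • (τ : UnitAddCircle) = ((b : ℝ) : UnitAddCircle) := by
    rw [UnitAddCircle.natCast_smul_coe, UnitAddCircle.coe_eq_coe_iff]
    exact ⟨-p, by rw [hp]; push_cast; ring⟩
  have h0 : (0 : UnitAddCircle) = ((0 : ℝ) : UnitAddCircle) := rfl
  simp only [hr, h0, UnitAddCircle.natCast_smul_coe]
  refine forall₂_congr fun j _ => ?_
  rw [coe_mem_cIoo_iff (by linarith) (by linarith), not_exists]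

theorem Irrational.fract_natCast_mul_pos {τ : ℝ} (hτ : Irrational τ) {r : ℕ} (hr : 1 ≤ r) :
    0 < Int.fract (r * τ) := by
  refine lt_of_le_of_ne (Int.fract_nonneg _) fun h => ?_
  have := Int.self_sub_floor (r * τ)
  have h2 := hτ.eq_zero_of_mul_add_eq_zero (j := r) (m := -⌊r * τ⌋)
    (by push_cast; linarith)
  omega

theorem isLeftNeighbour_leftTime {τ : ℝ} (hτ : Irrational τ) {n : ℕ}
    (h : 0 < leftTime (τ : UnitAddCircle) n) :
    IsLeftNeighbour τ n (leftTime (τ : UnitAddCircle) n) (leftGap (τ : UnitAddCircle) n) := by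
  obtain ⟨h₁, h₂, h₃⟩ := Nat.sInf_mem (Nat.nonempty_of_pos_sInf h)
  change 1 ≤ leftTime (τ : UnitAddCircle) n at h₁
  change leftTime (τ : UnitAddCircle) n ≤ n at h₂
  change ∀ j : ℕ, j ≤ n → j • (τ : UnitAddCircle) ∉
    Set.cIoo (leftTime (τ : UnitAddCircle) n • (τ : UnitAddCircle)) 0 at h₃
  have hf := hτ.fract_natCast_mul_pos h₁
  have hf1 := Int.fract_lt_one (leftTime (τ : UnitAddCircle) n * τ)
  have hs := Int.self_sub_floor (leftTime (τ : UnitAddCircle) n * τ)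
  have ha : leftGap (τ : UnitAddCircle) n = 1 - Int.fract (leftTime (τ : UnitAddCircle) n * τ) := by
    rw [leftGap, UnitAddCircle.natCast_smul_coe, ← AddCircle.coe_zero]
    apply arcLength_coe_eq (⌊leftTime (τ : UnitAddCircle) n * τ⌋ + 1)
    · push_cast; linarith
    · linarith
    · linarith
  have hp : leftGap (τ : UnitAddCircle) n =
      (⌊leftTime (τ : UnitAddCircle) n * τ⌋ + 1 : ℤ) - leftTime (τ : UnitAddCircle) n * τ := by
    rw [ha]; push_cast; linarith
  exact ⟨h₁, h₂, by linarith, by linarith, ⟨_, hp⟩,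
    (leftSet_iff hp (by linarith) (by linarith)).1 h₃⟩

theorem isRightNeighbour_rightTime {τ : ℝ} (hτ : Irrational τ) {n : ℕ}
    (h : 0 < rightTime (τ : UnitAddCircle) n) :
    IsRightNeighbour τ n (rightTime (τ : UnitAddCircle) n) (rightGap (τ : UnitAddCircle) n) := by
  obtain ⟨h₁, h₂, h₃⟩ := Nat.sInf_mem (Nat.nonempty_of_pos_sInf h)
  change 1 ≤ rightTime (τ : UnitAddCircle) n at h₁
  change rightTime (τ : UnitAddCircle) n ≤ n at h₂
  change ∀ j : ℕ, j ≤ n → j • (τ : UnitAddCircle) ∉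
    Set.cIoo 0 (rightTime (τ : UnitAddCircle) n • (τ : UnitAddCircle)) at h₃
  have hf := hτ.fract_natCast_mul_pos h₁
  have hf1 := Int.fract_lt_one (rightTime (τ : UnitAddCircle) n * τ)
  have hs := Int.self_sub_floor (rightTime (τ : UnitAddCircle) n * τ)
  have ha : rightGap (τ : UnitAddCircle) n = Int.fract (rightTime (τ : UnitAddCircle) n * τ) := by
    rw [rightGap, UnitAddCircle.natCast_smul_coe, ← AddCircle.coe_zero]
    apply arcLength_coe_eq (-⌊rightTime (τ : UnitAddCircle) n * τ⌋)
    · push_cast; linarith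
    · linarith
    · linarith
  have hp : rightGap (τ : UnitAddCircle) n =
      rightTime (τ : UnitAddCircle) n * τ - (⌊rightTime (τ : UnitAddCircle) n * τ⌋ : ℤ) := by
    rw [ha]; linarith
  exact ⟨h₁, h₂, by linarith, by linarith, ⟨_, hp⟩,
    (rightSet_iff hp (by linarith) (by linarith)).1 h₃⟩

theorem IsLeftNeighbour.unique {τ : ℝ} (hτ : Irrational τ) {n r r' : ℕ} {a a' : ℝ}
    (h : IsLeftNeighbour τ n r a) (h' : IsLeftNeighbour τ n r' a') : r = r' ∧ a = a' := by
  obtain ⟨p, hp⟩ := h.exists_eq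
  obtain ⟨p', hp'⟩ := h'.exists_eq
  have haa : a = a' := by
    rcases lt_trichotomy a a' with hlt | heq | hlt
    · exact absurd ⟨by push_cast; linarith, by push_cast; linarith [h.pos]⟩
        (h'.not_between r h.le (-p))
    · exact heq
    · exact absurd ⟨by push_cast; linarith, by push_cast; linarith [h'.pos]⟩
        (h.not_between r' h'.le (-p'))
  have := hτ.eq_zero_of_mul_add_eq_zero (j := (r : ℤ) - r') (m := p' - p)
    (by push_cast; linarith)
  exact ⟨by omega, haa⟩

theorem IsRightNeighbour.unique {τ : ℝ} (hτ : Irrational τ) {n r r' : ℕ} {a a' : ℝ}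
    (h : IsRightNeighbour τ n r a) (h' : IsRightNeighbour τ n r' a') : r = r' ∧ a = a' := by
  obtain ⟨p, hp⟩ := h.exists_eq
  obtain ⟨p', hp'⟩ := h'.exists_eq
  have haa : a = a' := by
    rcases lt_trichotomy a a' with hlt | heq | hlt
    · exact absurd ⟨by push_cast; linarith [h.pos], by push_cast; linarith⟩
        (h'.not_between r h.le (-p))
    · exact heq
    · exact absurd ⟨by push_cast; linarith [h'.pos], by push_cast; linarith⟩
        (h.not_between r' h'.le (-p'))
  have := hτ.eq_zero_of_mul_add_eq_zero (j := (r : ℤ) - r') (m := p' - p)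
    (by push_cast; linarith)
  exact ⟨by omega, haa⟩

theorem IsLeftNeighbour.leftTime_eq {τ : ℝ} (hτ : Irrational τ) {n r : ℕ} {a : ℝ}
    (h : IsLeftNeighbour τ n r a) :
    leftTime (τ : UnitAddCircle) n = r ∧ leftGap (τ : UnitAddCircle) n = a := by
  obtain ⟨p, hp⟩ := h.exists_eq
  have hmem : r ∈ {r : ℕ | 1 ≤ r ∧ r ≤ n ∧
      ∀ j : ℕ, j ≤ n → j • (τ : UnitAddCircle) ∉ Set.cIoo (r • (τ : UnitAddCircle)) 0} :=
    ⟨h.one_le, h.le, (leftSet_iff hp h.pos h.lt_one).2 h.not_between⟩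
  exact (isLeftNeighbour_leftTime hτ (Nat.sInf_mem ⟨r, hmem⟩).1).unique hτ h

theorem IsRightNeighbour.rightTime_eq {τ : ℝ} (hτ : Irrational τ) {n s : ℕ} {b : ℝ}
    (h : IsRightNeighbour τ n s b) :
    rightTime (τ : UnitAddCircle) n = s ∧ rightGap (τ : UnitAddCircle) n = b := by
  obtain ⟨p, hp⟩ := h.exists_eq
  have hmem : s ∈ {s : ℕ | 1 ≤ s ∧ s ≤ n ∧
      ∀ j : ℕ, j ≤ n → j • (τ : UnitAddCircle) ∉ Set.cIoo 0 (s • (τ : UnitAddCircle))} :=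
    ⟨h.one_le, h.le, (rightSet_iff hp h.pos h.lt_one).2 h.not_between⟩
  exact (isRightNeighbour_rightTime hτ (Nat.sInf_mem ⟨s, hmem⟩).1).unique hτ h

theorem IsBeforeClosestReturn.isNeighbour {τ : ℝ} (hτ : Irrational τ) {N : ℕ}
    (h : IsBeforeClosestReturn (τ : UnitAddCircle) N) :
    IsLeftNeighbour τ N (leftTime (τ : UnitAddCircle) N) (leftGap (τ : UnitAddCircle) N) ∧
    IsRightNeighbour τ N (rightTime (τ : UnitAddCircle) N) (rightGap (τ : UnitAddCircle) N) := by
  have h2 := h.2.1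
  constructor
  · apply isLeftNeighbour_leftTime hτ
    -- Time `0`, the value of `sInf ∅`, would give gap `0` and hence ratio `0`, outside `[1/2, 2]`.
    -- On the right the same happens because division by `0` gives `0`.
    refine Nat.pos_of_ne_zero fun h0 => ?_
    have : leftGap (τ : UnitAddCircle) N = 0 := by
      rw [leftGap, h0, zero_smul, ← AddCircle.coe_zero, arcLength_coe]
      simp
    rw [this] at h2
    norm_num at h2
  · apply isRightNeighbour_rightTime hτ
    refine Nat.pos_of_ne_zero fun h0 => ?_
    have : rightGap (τ : UnitAddCircle) N = 0 := by
      rw [rightGap, h0, zero_smul, ← AddCircle.coe_zero, arcLength_coe]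
      simp
    rw [this] at h2
    norm_num at h2

/-! ### Farey pairs and the existence of characteristic times -/

/-- The numbers `p / r` and `p' / s` are Farey neighbours on both sides of `τ`, with
`a = p - rτ` and `b = sτ - p'`. -/
structure IsFareyPair (τ : ℝ) (r s : ℕ) (a b : ℝ) : Prop where
  left_pos : 1 ≤ r
  right_pos : 1 ≤ s
  left_gap_pos : 0 < a
  right_gap_pos : 0 < b
  exists_eq : ∃ p p' : ℤ, a = p - r * τ ∧ b = s * τ - p' ∧ s * p - r * p' = 1

namespace IsFareyPair

variable {τ : ℝ} {r s : ℕ} {a b : ℝ}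

theorem neg (h : IsFareyPair τ r s a b) : IsFareyPair (-τ) s r b a := by
  obtain ⟨p, p', h₁, h₂, h₃⟩ := h.exists_eq
  refine ⟨h.right_pos, h.left_pos, h.right_gap_pos, h.left_gap_pos, -p', -p, ?_, ?_, ?_⟩
  · rw [h₂]; push_cast; ring
  · rw [h₁]; push_cast; ring
  · linarith

theorem of_neg (h : IsFareyPair (-τ) s r b a) : IsFareyPair τ r s a b := by
  simpa using h.neg

/-- The mediant replaces the farther neighbour: one step of the subtractive Euclidean algorithm on
the gaps. -/
theorem step (h : IsFareyPair τ r s a b) (hab : a < b) : IsFareyPair τ r (s + r) a (b - a) := by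
  obtain ⟨p, p', h₁, h₂, h₃⟩ := h.exists_eq
  refine ⟨h.left_pos, h.right_pos.trans (Nat.le_add_right _ _), h.left_gap_pos, sub_pos.2 hab,
    p, p' + p, h₁, ?_, ?_⟩
  · rw [h₁, h₂]; push_cast; ring
  · push_cast; linarith

theorem mul_add_mul_eq_one (h : IsFareyPair τ r s a b) : s * a + r * b = 1 := by
  obtain ⟨p, p', h₁, h₂, h₃⟩ := h.exists_eq
  have : ((s * p - r * p' : ℤ) : ℝ) = 1 := by rw [h₃]; norm_num
  push_cast at this
  rw [h₁, h₂]
  linarith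

theorem gap_ne (hτ : Irrational τ) (h : IsFareyPair τ r s a b) (k : ℕ) : b ≠ k * a := by
  obtain ⟨p, p', h₁, h₂, h₃⟩ := h.exists_eq
  intro he
  have := hτ.eq_zero_of_mul_add_eq_zero (j := s + k * r) (m := -p' - k * p)
    (by push_cast; rw [h₁, h₂] at he; linarith)
  have h4 := h.right_pos
  have h5 : (0 : ℤ) ≤ k * r := by positivity
  omega

/-- Subtracting `a` from `b` as long as `b > 2 * a` leaves `r` and `a` unchanged and terminates;
equality is excluded by irrationality. -/
theorem exists_run (hτ : Irrational τ) (h : IsFareyPair τ r s a b) (hab : a < b) :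
    ∃ s' b', s ≤ s' ∧ IsFareyPair τ r s' a b' ∧ a < b' ∧ b' < 2 * a := by
  obtain ⟨n, hn⟩ := exists_nat_gt (b / a)
  rw [div_lt_iff₀ h.left_gap_pos] at hn
  induction n generalizing s b with
  | zero => simp at hn; linarith [h.right_gap_pos]
  | succ n ih =>
    rcases lt_trichotomy b (2 * a) with hlt | heq | hgt
    · exact ⟨s, b, le_rfl, h, hab, hlt⟩
    · exact absurd (by exact_mod_cast heq) (h.gap_ne hτ 2)
    · obtain ⟨s', b', h₁, h₂⟩ := ih (h.step hab) (by linarith)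
        (by push_cast at hn; linarith)
      exact ⟨s', b', by omega, h₂⟩

theorem exists_balanced_of_lt (hτ : Irrational τ) (h : IsFareyPair τ r s a b) (hab : a < b) :
    ∃ r' s' a' b', r + s ≤ r' + s' ∧ IsFareyPair τ r' s' a' b' ∧
      (a' < b' ∧ b' < 2 * a' ∧ r' ≤ 2 * s' ∨ b' < a' ∧ a' < 2 * b' ∧ s' ≤ 2 * r') := by
  obtain ⟨s', b', hs, h', h₁, h₂⟩ := h.exists_run hτ hab
  by_cases hr : r ≤ 2 * s'
  · exact ⟨r, s', a, b', by omega, h', Or.inl ⟨h₁, h₂, hr⟩⟩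
  -- Now `2 * s' < r`. One more mediant makes the right gap `b' - a` the smaller one, with time `s'
  -- + r ≤ 2 * r`. The run on the other side keeps this time and only increases `r`, so the balance
  -- of times persists.
  · obtain ⟨r', a', hr', h'', h₃, h₄⟩ := (h'.step h₁).neg.exists_run hτ.neg (by linarith)
    exact ⟨r', s' + r, a', b' - a, by omega, h''.of_neg, Or.inr ⟨h₃, h₄, by omega⟩⟩

theorem lt_or_gt (hτ : Irrational τ) (h : IsFareyPair τ r s a b) : a < b ∨ b < a := by
  have := h.gap_ne hτ 1
  rw [Nat.cast_one, one_mul] at this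
  exact lt_or_gt_of_ne this.symm

theorem exists_balanced (hτ : Irrational τ) (h : IsFareyPair τ r s a b) :
    ∃ r' s' a' b', r + s ≤ r' + s' ∧ IsFareyPair τ r' s' a' b' ∧
      (a' < b' ∧ b' < 2 * a' ∧ r' ≤ 2 * s' ∨ b' < a' ∧ a' < 2 * b' ∧ s' ≤ 2 * r') := by
  rcases h.lt_or_gt hτ with hab | hab
  · exact h.exists_balanced_of_lt hτ hab
  · obtain ⟨s', r', b', a', h₁, h₂, h₃⟩ := h.neg.exists_balanced_of_lt hτ.neg hab
    exact ⟨r', s', a', b', by omega, h₂.of_neg, h₃.symm⟩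

theorem exists_large (hτ : Irrational τ) (M : ℕ) :
    ∃ r s a b, M ≤ r + s ∧ IsFareyPair τ r s a b := by
  induction M with
  | zero =>
    have h1 := Int.fract_lt_one τ
    have h2 := hτ.fract_natCast_mul_pos le_rfl
    rw [Nat.cast_one, one_mul] at h2
    have h3 := Int.self_sub_floor τ
    refine ⟨1, 1, 1 - Int.fract τ, Int.fract τ, by omega, le_rfl, le_rfl, by linarith, h2,
      ⌊τ⌋ + 1, ⌊τ⌋, ?_, ?_, ?_⟩
    · push_cast; linarith
    · push_cast; linarith
    · push_cast; ring
  | succ M ih =>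
    obtain ⟨r, s, a, b, hM, h⟩ := ih
    have h1 := h.left_pos
    have h2 := h.right_pos
    rcases h.lt_or_gt hτ with hab | hab
    · exact ⟨r, s + r, a, b - a, by omega, h.step hab⟩
    · exact ⟨r + s, s, a - b, b, by omega, (h.neg.step hab).of_neg⟩

/-- By unimodularity, `(j, m) = u (r, -p) + v (s, -p')` with integers `u`, `v`, so that `j τ + m =
-u a + v b`. If this lies in `(-a, 0)`, then either `u ≤ 0` and `v < 0`, whence `j < 0`, or `u, v ≥
1`, whence `j ≥ r + s`. -/
theorem isLeftNeighbour (h : IsFareyPair τ r s a b) : IsLeftNeighbour τ (r + s - 1) r a := by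
  obtain ⟨p, p', h₁, h₂, h₃⟩ := h.exists_eq
  have hr := h.left_pos
  have hs := h.right_pos
  have ha := h.left_gap_pos
  have hb := h.right_gap_pos
  refine ⟨hr, by omega, ha, ?_, ⟨p, h₁⟩, fun j hj m ⟨hm₁, hm₂⟩ => ?_⟩
  · have := h.mul_add_mul_eq_one
    have h5 : (1 : ℝ) ≤ s := by exact_mod_cast hs
    have h6 : (1 : ℝ) ≤ r := by exact_mod_cast hr
    nlinarith
  obtain ⟨u, hu⟩ : ∃ u, u = -(p' * j + s * m) := ⟨_, rfl⟩
  obtain ⟨v, hv⟩ : ∃ v, v = p * j + r * m := ⟨_, rfl⟩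
  have hj' : (j : ℤ) = u * r + v * s := by rw [hu, hv]; linear_combination (-(j : ℤ)) * h₃
  have hm' : m = -u * p - v * p' := by rw [hu, hv]; linear_combination (-m) * h₃
  have hx : j * τ + m = -u * a + v * b := by
    have h7 : (j : ℝ) = u * r + v * s := by exact_mod_cast hj'
    rw [hm', h7, h₁, h₂]; push_cast; ring
  rw [hx] at hm₁ hm₂
  rcases le_or_gt u 0 with hu0 | hu0
  · have h8 : (u : ℝ) ≤ 0 := by exact_mod_cast hu0
    have h9 : (v : ℝ) < 0 := by
      by_contra hcon
      push Not at hcon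
      nlinarith
    have h10 : v < 0 := by exact_mod_cast h9
    have : u * r ≤ 0 := mul_nonpos_of_nonpos_of_nonneg hu0 (by positivity)
    have : v * s < 0 := mul_neg_of_neg_of_pos h10 (by positivity)
    omega
  · have h8 : (1 : ℝ) ≤ u := by exact_mod_cast hu0
    have h9 : (0 : ℝ) < v := by
      by_contra hcon
      push Not at hcon
      nlinarith
    have h10 : 0 < v := by exact_mod_cast h9
    have : (r : ℤ) ≤ u * r := le_mul_of_one_le_left (by positivity) hu0
    have : (s : ℤ) ≤ v * s := le_mul_of_one_le_left (by positivity) h10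
    omega

theorem isRightNeighbour (h : IsFareyPair τ r s a b) : IsRightNeighbour τ (r + s - 1) s b := by
  have h' := h.neg.isLeftNeighbour
  have hr := h.left_pos
  obtain ⟨p, hp⟩ := h'.exists_eq
  refine ⟨h'.one_le, by omega, h'.pos, h'.lt_one, ⟨-p, by rw [hp]; push_cast; ring⟩,
    fun j hj m ⟨h₁, h₂⟩ => h'.not_between j (by omega) (-m) ⟨?_, ?_⟩⟩
  · push_cast; linarith
  · push_cast; linarith

end IsFareyPair

theorem exists_isPreCharacteristic_ge {τ : ℝ} (hτ : Irrational τ) (M : ℕ) :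
    ∃ N, M ≤ N ∧ IsPreCharacteristic (τ : UnitAddCircle) N := by
  obtain ⟨r₀, s₀, a₀, b₀, hM, h₀⟩ := IsFareyPair.exists_large hτ (M + 1)
  obtain ⟨r, s, a, b, hle, h, hgood⟩ := h₀.exists_balanced hτ
  obtain ⟨hl, ha⟩ := h.isLeftNeighbour.leftTime_eq hτ
  obtain ⟨hr, hb⟩ := h.isRightNeighbour.rightTime_eq hτ
  have ha₀ := h.left_gap_pos
  have hb₀ := h.right_gap_pos
  refine ⟨r + s - 1, by omega, ⟨?_, ?_⟩, ?_⟩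
  · have := h.left_pos
    omega
  · rw [ha, hb, Set.mem_Icc, le_div_iff₀ hb₀, div_le_iff₀ hb₀]
    rcases hgood with hg | hg <;> constructor <;> linarith
  · rw [ha, hb, hl, hr]
    exact hgood.imp (fun hg => ⟨hg.1, hg.2.2⟩) fun hg => ⟨hg.1, hg.2.2⟩

theorem exists_isCharacteristicSequence {τ : ℝ} (hτ : Irrational τ) :
    ∃ k : ℕ → ℕ, IsCharacteristicSequence (τ : UnitAddCircle) k := by
  obtain ⟨N, hN, hN'⟩ := Filter.extraction_of_frequently_atTop
    (Filter.frequently_atTop.2 fun M => exists_isPreCharacteristic_ge hτ M)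
  exact ⟨fun i => N i - 1, N, hN, hN', fun _ => rfl⟩

/-! ### Lower bound for the wandering time -/

/-- A value of `d τ` modulo `1` in `(-(a + b), -a)` would put `(r - d) τ` into `(0, b)`, and a value
in `(b, a + b)` would put `(s - d) τ` into `(-a, 0)`. Hence `(-a, b)` is disjoint from its translate
by `d τ`. -/
theorem IsLeftNeighbour.not_mem_of_lt {τ : ℝ} (hτ : Irrational τ) {N r s : ℕ} {a b : ℝ}
    (hl : IsLeftNeighbour τ N r a) (hr : IsRightNeighbour τ N s b) {d : ℕ} (hd : 1 ≤ d)
    (hdr : d < r) (hds : d < s) (m : ℤ) : ¬(-(a + b) < d * τ + m ∧ d * τ + m < a + b) := by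
  rintro ⟨h₁, h₂⟩
  obtain ⟨p, hp⟩ := hl.exists_eq
  obtain ⟨p', hp'⟩ := hr.exists_eq
  have hrN := hl.le
  have hsN := hr.le
  have hc₁ : ((r - d : ℕ) : ℝ) = r - d := Nat.cast_sub hdr.le
  have hc₂ : ((s - d : ℕ) : ℝ) = s - d := Nat.cast_sub hds.le
  have e₁ := hl.not_between d (by omega) m
  have e₂ := hr.not_between d (by omega) m
  have e₃ := hr.not_between (r - d) (by omega) (-p - m)
  have e₄ := hl.not_between (s - d) (by omega) (-p' - m)
  rw [hc₁] at e₃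
  rw [hc₂] at e₄
  push_cast at e₃ e₄
  have n₀ : (d * τ + m : ℝ) ≠ 0 := fun h0 => by
    have := hτ.eq_zero_of_mul_add_eq_zero (j := d) (m := m) (by exact_mod_cast h0)
    omega
  have n₁ : (d * τ + m : ℝ) ≠ -a := fun h0 => by
    have := hτ.eq_zero_of_mul_add_eq_zero (j := (d : ℤ) - r) (m := m + p)
      (by push_cast; linarith)
    omega
  have n₂ : (d * τ + m : ℝ) ≠ b := fun h0 => by
    have := hτ.eq_zero_of_mul_add_eq_zero (j := (d : ℤ) - s) (m := m + p')
      (by push_cast; linarith)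
    omega
  rcases lt_or_gt_of_ne n₀ with h0 | h0
  · rcases lt_or_gt_of_ne n₁ with h3 | h3
    · exact e₃ ⟨by linarith, by linarith⟩
    · exact e₁ ⟨h3, h0⟩
  · rcases lt_or_gt_of_ne n₂ with h3 | h3
    · exact e₂ ⟨h0, h3⟩
    · exact e₄ ⟨by linarith, by linarith⟩

/-- Dirichlet's approximation theorem yields an orbit point within `1 / (N + 1)` of zero. -/
theorem IsLeftNeighbour.min_gap_le {τ : ℝ} (hτ : Irrational τ) {N r s : ℕ} {a b : ℝ}
    (hl : IsLeftNeighbour τ N r a) (hr : IsRightNeighbour τ N s b) :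
    min a b ≤ 1 / (N + 1) := by
  have hN : 0 < N := hl.one_le.trans hl.le
  obtain ⟨j, hj, hjN, hle⟩ := Real.exists_nat_abs_mul_sub_round_le τ hN
  by_contra! hlt
  obtain ⟨ha, hb⟩ := lt_min_iff.1 hlt
  have e₁ := hl.not_between j hjN (-round (j * τ))
  have e₂ := hr.not_between j hjN (-round (j * τ))
  push_cast at e₁ e₂
  obtain ⟨h₁, h₂⟩ := abs_le.1 hle
  rcases lt_trichotomy ((j : ℝ) * τ - round (j * τ)) 0 with h0 | h0 | h0
  · exact e₁ ⟨by linarith, by linarith⟩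
  · have := hτ.eq_zero_of_mul_add_eq_zero (j := j) (m := -round (j * τ))
      (by push_cast; linarith)
    omega
  · exact e₂ ⟨by linarith, by linarith⟩

theorem Irrational.exists_forall_le_abs {τ : ℝ} (hτ : Irrational τ) (K : ℕ) :
    ∃ ε > 0, ∀ j : ℕ, 1 ≤ j → j ≤ K → ∀ m : ℤ, ε ≤ |j * τ + m| := by
  induction K with
  | zero => exact ⟨1, one_pos, fun j h₁ h₂ => by omega⟩
  | succ K ih =>
    obtain ⟨ε, hε, h⟩ := ih
    have h0 : 0 < |((K + 1 : ℕ) : ℝ) * τ - round (((K + 1 : ℕ) : ℝ) * τ)| := by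
      refine abs_pos.2 fun h0 => ?_
      have := hτ.eq_zero_of_mul_add_eq_zero (j := (K + 1 : ℕ))
        (m := -round (((K + 1 : ℕ) : ℝ) * τ)) (by push_cast at h0 ⊢; linarith)
      omega
    refine ⟨min ε _, lt_min hε h0, fun j h₁ h₂ m => ?_⟩
    rcases Nat.lt_or_ge j (K + 1) with hj | hj
    · exact (min_le_left _ _).trans (h j h₁ (by omega) m)
    · obtain rfl : j = K + 1 := le_antisymm h₂ hj
      refine (min_le_right _ _).trans ?_
      have := round_le (((K + 1 : ℕ) : ℝ) * τ) (-m)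
      rwa [Int.cast_neg, sub_neg_eq_add] at this

/-- For large `N` the smaller gap is small, and by balance so is the other. The first `K` multiples
of `τ` stay away from the integers, so neither neighbour can be among them. -/
theorem exists_forall_min_time_ge {τ : ℝ} (hτ : Irrational τ) (K : ℕ) :
    ∃ N₀, ∀ N, N₀ ≤ N → ∀ r s a b, IsLeftNeighbour τ N r a → IsRightNeighbour τ N s b →
      a ≤ 2 * b → b ≤ 2 * a → K < r ∧ K < s ∧ a + b < 1 := by
  obtain ⟨ε, hε, h⟩ := hτ.exists_forall_le_abs K
  obtain ⟨n, hn⟩ := exists_nat_gt (2 / ε)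
  refine ⟨n + 3, fun N hN r s a b hl hr hab hba => ?_⟩
  have hmin := hl.min_gap_le hτ hr
  have hn' : 2 / ε < N + 1 := hn.trans (by
    have : (n : ℝ) + 3 ≤ N := by exact_mod_cast hN
    linarith)
  have hsmall : 2 * (1 / ((N : ℝ) + 1)) < ε := by
    rw [div_lt_iff₀ hε] at hn'
    rw [mul_one_div, div_lt_iff₀ (by positivity)]
    linarith
  have hthird : 1 / ((N : ℝ) + 1) ≤ 1 / 4 := by
    apply one_div_le_one_div_of_le (by norm_num)
    have : (3 : ℝ) ≤ N := by exact_mod_cast (by omega : 3 ≤ N)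
    linarith
  obtain ⟨p, hp⟩ := hl.exists_eq
  obtain ⟨p', hp'⟩ := hr.exists_eq
  have hbound : a ≤ 2 * (1 / ((N : ℝ) + 1)) ∧ b ≤ 2 * (1 / ((N : ℝ) + 1)) ∧ a + b < 1 := by
    have := hl.pos
    have := hr.pos
    rcases min_le_iff.1 hmin with h3 | h3 <;> refine ⟨?_, ?_, ?_⟩ <;> linarith
  refine ⟨?_, ?_, hbound.2.2⟩
  · by_contra! hK
    have := h r hl.one_le hK (-p)
    rw [show (r : ℝ) * τ + (-p : ℤ) = -a by rw [hp]; push_cast; ring, abs_neg,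
      abs_of_pos hl.pos] at this
    linarith
  · by_contra! hK
    have := h s hr.one_le hK (-p')
    rw [show (s : ℝ) * τ + (-p' : ℤ) = b by rw [hp']; push_cast; ring,
      abs_of_pos hr.pos] at this
    linarith

theorem IsLeftNeighbour.mono {τ : ℝ} {N n r : ℕ} {a : ℝ} (hl : IsLeftNeighbour τ N r a)
    (hn : n ≤ N) (hr : r ≤ n) : IsLeftNeighbour τ n r a :=
  ⟨hl.one_le, hr, hl.pos, hl.lt_one, hl.exists_eq, fun j hj => hl.not_between j (hj.trans hn)⟩

theorem IsRightNeighbour.mono {τ : ℝ} {N n r : ℕ} {a : ℝ} (hl : IsRightNeighbour τ N r a)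
    (hn : n ≤ N) (hr : r ≤ n) : IsRightNeighbour τ n r a :=
  ⟨hl.one_le, hr, hl.pos, hl.lt_one, hl.exists_eq, fun j hj => hl.not_between j (hj.trans hn)⟩

section Wandering

variable {τ : ℝ} {n r s : ℕ} {a b : ℝ}

theorem mem_rotateSet_arcI_iff (hτ : Irrational τ) (hl : IsLeftNeighbour τ n r a)
    (hr : IsRightNeighbour τ n s b) (hab : a + b < 1) (k : ℤ) (z : ℝ) :
    (z : UnitAddCircle) ∈ rotateSet (τ : UnitAddCircle) k (arcI (τ : UnitAddCircle) n) ↔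
      ∃ m : ℤ, -a < z - k * τ + m ∧ z - k * τ + m < b := by
  have ha := hl.pos
  have hb := hr.pos
  rw [← mem_rotateSet_cIoo_iff (by linarith) (by linarith), arcI, (hl.leftTime_eq hτ).1,
    (hr.rightTime_eq hτ).1]
  obtain ⟨p, hp⟩ := hl.exists_eq
  obtain ⟨p', hp'⟩ := hr.exists_eq
  have h₁ : r • (τ : UnitAddCircle) = ((-a : ℝ) : UnitAddCircle) := by
    rw [UnitAddCircle.natCast_smul_coe, UnitAddCircle.coe_eq_coe_iff]
    exact ⟨-p, by rw [hp]; push_cast; ring⟩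
  have h₂ : s • (τ : UnitAddCircle) = ((b : ℝ) : UnitAddCircle) := by
    rw [UnitAddCircle.natCast_smul_coe, UnitAddCircle.coe_eq_coe_iff]
    exact ⟨-p', by rw [hp']; push_cast; ring⟩
  rw [h₁, h₂]

/-- Because `r + s = n + 2`, the end points of `J_n` are `(r - 2) τ` and `(s - 2) τ`: the arc `J_n`
is `I_n` rotated by `-2 τ`. -/
theorem mem_rotateSet_arcJ_iff (hτ : Irrational τ) (hl : IsLeftNeighbour τ n r a)
    (hr : IsRightNeighbour τ n s b) (hab : a + b < 1) (hrs : r + s = n + 2) (k : ℤ) (z : ℝ) :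
    (z : UnitAddCircle) ∈ rotateSet (τ : UnitAddCircle) k (arcJ (τ : UnitAddCircle) n) ↔
      ∃ m : ℤ, -a < z - (k - 2) * τ + m ∧ z - (k - 2) * τ + m < b := by
  have ha := hl.pos
  have hb := hr.pos
  obtain ⟨p, hp⟩ := hl.exists_eq
  obtain ⟨p', hp'⟩ := hr.exists_eq
  have hrs' : (r : ℝ) + s = n + 2 := by exact_mod_cast hrs
  have h₁ : ((n : ℤ) - s) • (τ : UnitAddCircle) = ((-a - 2 * τ : ℝ) : UnitAddCircle) := by
    rw [UnitAddCircle.intCast_smul_coe, UnitAddCircle.coe_eq_coe_iff]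
    refine ⟨-p, ?_⟩
    rw [hp]; push_cast; linear_combination (-τ) * hrs'
  have h₂ : ((n : ℤ) - r) • (τ : UnitAddCircle) = ((b - 2 * τ : ℝ) : UnitAddCircle) := by
    rw [UnitAddCircle.intCast_smul_coe, UnitAddCircle.coe_eq_coe_iff]
    refine ⟨-p', ?_⟩
    rw [hp']; push_cast; linear_combination (-τ) * hrs'
  rw [arcJ, (hl.leftTime_eq hτ).1, (hr.rightTime_eq hτ).1, h₁, h₂,
    mem_rotateSet_cIoo_iff (by linarith) (by linarith)]
  refine exists_congr fun m => and_congr ?_ ?_ <;> constructor <;> intro h <;> linarith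

theorem not_mem_of_translates (hτ : Irrational τ) {N : ℕ} (hl : IsLeftNeighbour τ N r a)
    (hr : IsRightNeighbour τ N s b) {i j : ℤ} (hne : i ≠ j) (h₁ : |i - j| < r)
    (h₂ : |i - j| < s) {z : ℝ} (hi : ∃ m : ℤ, -a < z - i * τ + m ∧ z - i * τ + m < b)
    (hj : ∃ m : ℤ, -a < z - j * τ + m ∧ z - j * τ + m < b) : False := by
  wlog hij : j < i generalizing i j
  · exact this hne.symm (by rwa [abs_sub_comm]) (by rwa [abs_sub_comm]) hj hi (by omega)
  obtain ⟨m, hm₁, hm₂⟩ := hi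
  obtain ⟨m', hm₁', hm₂'⟩ := hj
  obtain ⟨d, hd⟩ := Int.eq_ofNat_of_zero_le (by omega : 0 ≤ i - j)
  rw [hd, Int.abs_natCast] at h₁ h₂
  have hd' : (i : ℝ) - j = d := by exact_mod_cast hd
  refine hl.not_mem_of_lt hτ hr (d := d) (by omega) (by omega) (by omega) (m' - m) ⟨?_, ?_⟩
  · rw [← hd']; push_cast; linarith
  · rw [← hd']; push_cast; linarith

/-- All the arcs are translates of `I_n` by exponents in `[-w - 2, -2]` or `[0, w]`, so exponents
differ by at most `2 * w + 2`. -/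
theorem wandersFor_of_lt (hτ : Irrational τ) {N w : ℕ} (hl : IsLeftNeighbour τ N r a)
    (hr : IsRightNeighbour τ N s b) (hab : a + b < 1) (hrs : r + s = N + 1)
    (hwr : 2 * w + 2 < r) (hws : 2 * w + 2 < s) :
    WandersFor (τ : UnitAddCircle) (N - 1) w := by
  have hl' := hl.mono (Nat.sub_le N 1) (by omega)
  have hr' := hr.mono (Nat.sub_le N 1) (by omega)
  have hI := mem_rotateSet_arcI_iff hτ hl' hr' hab
  have hJ := mem_rotateSet_arcJ_iff hτ hl' hr' hab (by omega)
  have key : ∀ {i j : ℤ}, i ≠ j → |i - j| < r → |i - j| < s → ∀ {z : ℝ},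
      (∃ m : ℤ, -a < z - i * τ + m ∧ z - i * τ + m < b) →
      (∃ m : ℤ, -a < z - j * τ + m ∧ z - j * τ + m < b) → False :=
    not_mem_of_translates hτ hl hr
  refine ⟨fun i j hi hj hij => ?_, fun i j hi hj hij => ?_, fun i j hi hj => ?_⟩ <;>
    refine Set.disjoint_left.2 fun z => ?_ <;>
    induction z using QuotientAddGroup.induction_on with | H z => ?_ <;>
    intro h₁ h₂
  · rw [hI] at h₁ h₂
    refine key (by omega) ?_ ?_ h₁ h₂ <;> rw [abs_lt] <;> constructor <;> omega
  · rw [hJ] at h₁ h₂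
    refine key (i := -(i : ℤ) - 2) (j := -(j : ℤ) - 2) (by omega) ?_ ?_ (by simpa using h₁)
      (by simpa using h₂) <;> rw [abs_lt] <;> constructor <;> omega
  · rw [hI] at h₁
    rw [hJ] at h₂
    refine key (j := -(j : ℤ) - 2) (by omega) ?_ ?_ h₁ (by simpa using h₂) <;>
      rw [abs_lt] <;> constructor <;> omega

/-- Rotation by `r + s` steps moves by `b - a`, which takes `0` to a point of `I_n`. Boundedness
makes the `sSup` defining the wandering time meaningful. -/
theorem bddAbove_wandersFor (hτ : Irrational τ) (hl : IsLeftNeighbour τ n r a)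
    (hr : IsRightNeighbour τ n s b) (hab : a + b < 1) :
    BddAbove {w : ℕ | WandersFor (τ : UnitAddCircle) n w} := by
  refine ⟨r + s, fun w hw => ?_⟩
  by_contra! hlt
  have ha := hl.pos
  have hb := hr.pos
  have hr1 := hr.one_le
  have hI := mem_rotateSet_arcI_iff hτ hl hr hab
  obtain ⟨p, hp⟩ := hl.exists_eq
  obtain ⟨p', hp'⟩ := hr.exists_eq
  refine Set.disjoint_left.1 (hw.1 0 (r + s) (by omega) hlt.le (by omega))
    ((hI _ (b - a)).2 ⟨0, ?_, ?_⟩) ((hI _ (b - a)).2 ⟨p + p', ?_, ?_⟩)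
  all_goals push_cast
  · linarith
  · linarith
  · linarith
  · linarith

theorem min_time_le_wanderingTime (hτ : Irrational τ) {N : ℕ} (hl : IsLeftNeighbour τ N r a)
    (hr : IsRightNeighbour τ N s b) (hab : a + b < 1) (hrs : r + s = N + 1)
    (hr2 : 2 < r) (hs2 : 2 < s) :
    min r s ≤ 2 * wanderingTime (τ : UnitAddCircle) (N - 1) + 4 := by
  have hbdd := bddAbove_wandersFor hτ (hl.mono (Nat.sub_le N 1) (by omega))
    (hr.mono (Nat.sub_le N 1) (by omega)) hab
  -- The largest `w` with `2 * w + 2 < min r s`.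
  have := le_csSup hbdd (wandersFor_of_lt hτ (w := (min r s - 3) / 2) hl hr hab hrs
    (by omega) (by omega))
  change _ ≤ wanderingTime (τ : UnitAddCircle) (N - 1) at this
  omega

end Wandering

/-! ### Subexponential growth of the derivative -/

/-- Uniform continuity handles close points and boundedness the others. A bound linear in the
distance can be summed along an orbit of arcs. -/
theorem Function.Periodic.exists_abs_sub_le {φ : ℝ → ℝ} (hφ : Function.Periodic φ 1)
    (hc : Continuous φ) {ε : ℝ} (hε : 0 < ε) :
    ∃ L ≥ 0, ∀ s t, |φ s - φ t| ≤ ε + L * |s - t| := by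
  obtain ⟨M, hM⟩ := (hφ.isBounded_of_continuous one_ne_zero hc).exists_norm_le
  replace hM : ∀ s, |φ s| ≤ M := fun s => hM _ ⟨s, rfl⟩
  have hM0 : 0 ≤ M := (abs_nonneg _).trans (hM 0)
  obtain ⟨δ, hδ, h⟩ := Metric.uniformContinuousOn_iff.1
    ((isCompact_Icc (a := (-1 : ℝ)) (b := 2)).uniformContinuousOn_of_continuous hc.continuousOn)
    ε hε
  have hδ' : 0 < min δ 1 := lt_min hδ one_pos
  refine ⟨2 * M / min δ 1, by positivity, fun s t => ?_⟩
  rcases lt_or_ge |s - t| (min δ 1) with hst | hst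
  · obtain ⟨h₁, h₂⟩ := lt_min_iff.1 hst
    obtain ⟨h₃, h₄⟩ := abs_lt.1 h₂
    have hs := Int.self_sub_floor s
    have hs0 := Int.fract_nonneg s
    have hs1 := Int.fract_lt_one s
    have hd := h (s - ⌊s⌋) ⟨by linarith, by linarith⟩ (t - ⌊s⌋) ⟨by linarith, by linarith⟩
      (by rwa [Real.dist_eq, sub_sub_sub_cancel_right])
    have e : ∀ y, φ (y - ⌊s⌋) = φ y := fun y => by
      simpa using hφ.sub_int_mul_eq (x := y) ⌊s⌋
    rw [e, e, Real.dist_eq] at hd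
    have : 0 ≤ 2 * M / min δ 1 * |s - t| := by positivity
    linarith
  · have h₁ : |φ s - φ t| ≤ 2 * M := (abs_sub _ _).trans (by linarith [hM s, hM t])
    have h₂ : 2 * M ≤ 2 * M / min δ 1 * |s - t| := by
      rw [div_mul_eq_mul_div, le_div_iff₀ hδ']
      exact mul_le_mul_of_nonneg_left hst (by positivity)
    linarith

/-- The intervals project injectively, up to measure zero, onto disjoint subsets of a circle of
measure `1`. -/
theorem sum_length_le_one {q : ℕ} {u v : ℕ → ℝ}
    (hv : ∀ i < q, v i ≤ u i + 1) (hdisj : ∀ i < q, ∀ j < q, i < j →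
      ∀ y ∈ Set.Ioo (u i) (v i), ∀ z ∈ Set.Ioo (u j) (v j), ∀ m : ℤ, y + m ≠ z) :
    ∑ i ∈ Finset.range q, (v i - u i) ≤ 1 := by
  let B : ℕ → Set UnitAddCircle := fun i => ((↑) : ℝ → UnitAddCircle) '' Set.Ioo (u i) (v i)
  have hmeas : ∀ i, MeasurableSet (B i) := fun i =>
    (QuotientAddGroup.isOpenMap_coe _ isOpen_Ioo).measurableSet
  have hlt : ∀ i < q, ∀ j < q, i < j → Disjoint (B i) (B j) := by
    intro i hi j hj hij
    rw [Set.disjoint_left]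
    rintro _ ⟨y, hy, rfl⟩ ⟨z, hz, hyz⟩
    obtain ⟨m, hm⟩ := UnitAddCircle.coe_eq_coe_iff.1 hyz.symm
    exact hdisj i hi j hj hij y hy z hz m hm
  have hpair : (↑(Finset.range q) : Set ℕ).PairwiseDisjoint B := by
    intro i hi j hj hij
    rw [Finset.mem_coe, Finset.mem_range] at hi hj
    rcases lt_or_gt_of_ne hij with h | h
    · exact hlt i hi j hj h
    · exact (hlt j hj i hi h).symm
  have hvol : ∀ i ∈ Finset.range q, ENNReal.ofReal (v i - u i) ≤ MeasureTheory.volume (B i) := by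
    intro i hi
    rw [← (UnitAddCircle.measurePreserving_mk (u i)).measure_preimage (hmeas i).nullMeasurableSet,
      ← Real.volume_Ioo]
    have hsub : Set.Ioo (u i) (v i) ⊆ Set.Ioc (u i) (u i + 1) := fun y hy =>
      ⟨hy.1, hy.2.le.trans (hv i (Finset.mem_range.1 hi))⟩
    rw [← MeasureTheory.Measure.restrict_eq_self MeasureTheory.volume hsub]
    exact MeasureTheory.measure_mono (Set.subset_preimage_image _ _)
  have hsum : ∑ i ∈ Finset.range q, ENNReal.ofReal (v i - u i) ≤ 1 := by
    refine (Finset.sum_le_sum hvol).trans ?_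
    rw [← MeasureTheory.measure_biUnion_finset hpair fun i _ => hmeas i,
      ← UnitAddCircle.measure_univ]
    exact MeasureTheory.measure_mono (Set.subset_univ _)
  calc ∑ i ∈ Finset.range q, (v i - u i)
      ≤ ∑ i ∈ Finset.range q, (ENNReal.ofReal (v i - u i)).toReal :=
        Finset.sum_le_sum fun i _ => by
          rw [ENNReal.toReal_ofReal']; exact le_max_left _ _
    _ = (∑ i ∈ Finset.range q, ENNReal.ofReal (v i - u i)).toReal :=
        (ENNReal.toReal_sum fun _ _ => ENNReal.ofReal_ne_top).symm
    _ ≤ 1 := ENNReal.toReal_le_of_le_ofReal zero_le_one (by simpa using hsum)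

namespace CircleDeg1Lift

variable {f : CircleDeg1Lift}

/-- The displacement of `f ^ j` lies strictly between consecutive integers because `j` times the
translation number does; periodicity and compactness make this uniform. -/
theorem exists_forall_le_abs_pow_sub (hf : Continuous f) (hτ : Irrational f.translationNumber)
    {j : ℕ} (hj : 1 ≤ j) : ∃ c > 0, ∀ x : ℝ, ∀ m : ℤ, c ≤ |(f ^ j) x - x + m| := by
  have hirr : Irrational (j * f.translationNumber) := hτ.natCast_mul (by omega)
  have hlo : ∀ x, x + ⌊j * f.translationNumber⌋ < (f ^ j) x :=
    lt_map_of_int_lt_translationNumber _ (by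
      rw [translationNumber_pow]
      exact lt_of_le_of_ne (Int.floor_le _) (hirr.ne_int _).symm)
  have hhi : ∀ x, (f ^ j) x < x + (⌊j * f.translationNumber⌋ + 1 : ℤ) :=
    map_lt_of_translationNumber_lt_int _ (by
      rw [translationNumber_pow]
      push_cast
      exact Int.lt_floor_add_one _)
  have hper : Function.Periodic (fun x => (f ^ j) x - x) 1 := fun x => by
    simp only [map_add_one]
    ring
  have hcont : Continuous fun x => (f ^ j) x - x := (continuous_pow f hf j).sub continuous_id
  have hcpt := hper.compact_of_continuous one_ne_zero hcont
  obtain ⟨_, ⟨⟨x₀, rfl⟩, hmin⟩⟩ := hcpt.exists_isLeast (Set.range_nonempty _)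
  obtain ⟨_, ⟨⟨x₁, rfl⟩, hmax⟩⟩ := hcpt.exists_isGreatest (Set.range_nonempty _)
  have h₀ := hlo x₀
  have h₁ := hhi x₁
  push_cast at h₁
  refine ⟨min ((f ^ j) x₀ - x₀ - ⌊j * f.translationNumber⌋)
    (⌊j * f.translationNumber⌋ + 1 - ((f ^ j) x₁ - x₁)), lt_min (by linarith) (by linarith),
    fun x m => ?_⟩
  have hx₀ : (f ^ j) x₀ - x₀ ≤ (f ^ j) x - x := hmin ⟨x, rfl⟩
  have hx₁ : (f ^ j) x - x ≤ (f ^ j) x₁ - x₁ := hmax ⟨x, rfl⟩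
  rcases le_or_gt (-⌊j * f.translationNumber⌋) m with hm | hm
  · have hm' : (-⌊j * f.translationNumber⌋ : ℝ) ≤ m := by exact_mod_cast hm
    exact (min_le_left _ _).trans (le_trans (by linarith) (le_abs_self _))
  · have hm' : (m : ℝ) + 1 ≤ -⌊j * f.translationNumber⌋ := by exact_mod_cast hm
    exact (min_le_right _ _).trans (le_trans (by linarith) (neg_le_abs _))

theorem exists_forall_le_abs_pow_sub_of_le (hf : Continuous f)
    (hτ : Irrational f.translationNumber) (q : ℕ) :
    ∃ c > 0, c ≤ 1 ∧
      ∀ j : ℕ, 1 ≤ j → j ≤ q → ∀ x : ℝ, ∀ m : ℤ, c ≤ |(f ^ j) x - x + m| := by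
  induction q with
  | zero => exact ⟨1, one_pos, le_rfl, fun j h₁ h₂ => by omega⟩
  | succ q ih =>
    obtain ⟨c, hc, hc1, h⟩ := ih
    obtain ⟨c', hc', h'⟩ := exists_forall_le_abs_pow_sub hf hτ (Nat.le_add_left 1 q)
    refine ⟨min c c', lt_min hc hc', (min_le_left _ _).trans hc1, fun j h₁ h₂ x m => ?_⟩
    rcases Nat.lt_or_ge j (q + 1) with hj | hj
    · exact (min_le_left _ _).trans (h j h₁ (by omega) x m)
    · obtain rfl : j = q + 1 := le_antisymm h₂ hj
      exact (min_le_right _ _).trans (h' x m)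

theorem strictMono_pow (hf : StrictMono f) (n : ℕ) : StrictMono (f ^ n : CircleDeg1Lift) := by
  rw [coe_pow]
  exact hf.iterate n

/-- An arc of length `c` is disjoint from its first `q` iterates, since these displace every point
by at least `c` modulo `1`. So `q` consecutive images are disjoint on the circle. -/
theorem sum_length_iterates_le_one (hf : Continuous f) (hmono : StrictMono f) {q : ℕ} {c : ℝ}
    (hc1 : c ≤ 1)
    (hc : ∀ j : ℕ, 1 ≤ j → j ≤ q → ∀ x : ℝ, ∀ m : ℤ, c ≤ |(f ^ j) x - x + m|) (x : ℝ) (K : ℕ) :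
    ∑ j ∈ Finset.range q, ((f ^ (K + j)) (x + c) - (f ^ (K + j)) x) ≤ 1 := by
  refine sum_length_le_one (fun i _ => ?_) fun i hi j hj hij y hy z hz m hyz => ?_
  · rw [← map_add_one]
    exact (f ^ (K + i)).monotone (by linarith)
  · have hxc : x ≤ x + c := by
      by_contra! hlt
      exact absurd (hy.1.trans hy.2) ((strictMono_pow hmono (K + i)) hlt).not_gt
    obtain ⟨y', hy', rfl⟩ := intermediate_value_Ioo hxc
      (continuous_pow f hf (K + i)).continuousOn hy
    obtain ⟨z', hz', rfl⟩ := intermediate_value_Ioo hxc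
      (continuous_pow f hf (K + j)).continuousOn hz
    have hsplit : (f ^ (K + j)) z' = (f ^ (K + i)) ((f ^ (j - i)) z') := by
      rw [← mul_apply, ← pow_add, show K + i + (j - i) = K + j by omega]
    rw [hsplit, ← map_add_int] at hyz
    have hinj := (strictMono_pow hmono (K + i)).injective hyz
    have := hc (j - i) (by omega) (by omega) z' (-m)
    rw [← hinj, Int.cast_neg] at this
    have habs : |y' + m - z' + -(m : ℝ)| < c := by
      rw [abs_lt]
      constructor <;> linarith [hy'.1, hy'.2, hz'.1, hz'.2]
    linarith

theorem sum_length_iterates_le (hf : Continuous f) (hmono : StrictMono f) {q : ℕ} (hq : 0 < q)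
    {c : ℝ} (hc0 : 0 ≤ c) (hc1 : c ≤ 1)
    (hc : ∀ j : ℕ, 1 ≤ j → j ≤ q → ∀ x : ℝ, ∀ m : ℤ, c ≤ |(f ^ j) x - x + m|) (x : ℝ) (n : ℕ) :
    ∑ j ∈ Finset.range n, ((f ^ j) (x + c) - (f ^ j) x) ≤ n / q + 1 := by
  have hblock : ∀ K : ℕ,
      ∑ j ∈ Finset.range (K * q), ((f ^ j) (x + c) - (f ^ j) x) ≤ K := by
    intro K
    induction K with
    | zero => simp
    | succ K ih =>
      rw [Nat.succ_mul, Finset.sum_range_add]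
      have := sum_length_iterates_le_one hf hmono hc1 hc x (K * q)
      push_cast
      linarith
  have hn : n ≤ (n / q + 1) * q := by
    have := Nat.div_add_mod n q
    have := Nat.mod_lt n hq
    rw [add_mul, one_mul, mul_comm]
    omega
  calc ∑ j ∈ Finset.range n, ((f ^ j) (x + c) - (f ^ j) x)
      ≤ ∑ j ∈ Finset.range ((n / q + 1) * q), ((f ^ j) (x + c) - (f ^ j) x) :=
        Finset.sum_le_sum_of_subset_of_nonneg (Finset.range_mono hn) fun j _ _ =>
          sub_nonneg.2 ((f ^ j).monotone (by linarith))
    _ ≤ ((n / q + 1 : ℕ) : ℝ) := hblock _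
    _ ≤ n / q + 1 := by
        push_cast
        linarith [Nat.cast_div_le (α := ℝ) (m := n) (n := q)]

theorem hasDerivAt_pow (hf : Differentiable ℝ f) (n : ℕ) (x : ℝ) :
    HasDerivAt (f ^ n : CircleDeg1Lift) (∏ j ∈ Finset.range n, deriv f ((f ^ j) x)) x := by
  induction n with
  | zero => simpa using hasDerivAt_id x
  | succ n ih =>
    rw [Finset.prod_range_succ, mul_comm, pow_succ', coe_mul]
    exact (hf _).hasDerivAt.comp x ih

/-- A `C¹` circle diffeomorphism without periodic points has no exponential growth of the
derivative. -/
theorem exists_abs_pow_sub_le (hf : ContDiff ℝ 1 f) (hpos : ∀ x, 0 < deriv f x)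
    (hτ : Irrational f.translationNumber) {μ : ℝ} (hμ : 1 < μ) :
    ∃ C > 0, ∀ n : ℕ, ∀ u v : ℝ, |(f ^ n) u - (f ^ n) v| ≤ C * μ ^ n * |u - v| := by
  have hdiff : Differentiable ℝ f := hf.differentiable one_ne_zero
  have hmono : StrictMono f := strictMono_of_deriv_pos hpos
  have hlog : 0 < Real.log μ := Real.log_pos hμ
  let φ : ℝ → ℝ := fun x => Real.log (deriv f x)
  have hφc : Continuous φ := (hf.continuous_deriv le_rfl).log fun x => (hpos x).ne'
  have hφp : Function.Periodic φ 1 := fun x => by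
    have : deriv (fun y => f (y + 1)) x = deriv f x := by
      simp only [map_add_one, deriv_add_const]
    rw [deriv_comp_add_const] at this
    simp only [φ, this]
  obtain ⟨L, hL, hφ⟩ := hφp.exists_abs_sub_le hφc (half_pos hlog)
  obtain ⟨q, hq⟩ := exists_nat_gt (L / (Real.log μ / 2))
  rw [div_lt_iff₀ (half_pos hlog)] at hq
  have hq0 : 0 < q := Nat.pos_of_ne_zero fun h0 => by
    rw [h0, Nat.cast_zero, zero_mul] at hq
    linarith
  have hq0' : (0 : ℝ) < q := by exact_mod_cast hq0
  obtain ⟨c, hc, hc1, hcq⟩ := exists_forall_le_abs_pow_sub_of_le hf.continuous hτ q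
  have hexp : ∀ n x, ∏ j ∈ Finset.range n, deriv f ((f ^ j) x) =
      Real.exp (∑ j ∈ Finset.range n, φ ((f ^ j) x)) := fun n x => by
    rw [Real.exp_sum]
    exact Finset.prod_congr rfl fun j _ => (Real.exp_log (hpos _)).symm
  have hderiv : ∀ n x, ∏ j ∈ Finset.range n, deriv f ((f ^ j) x) ≤
      Real.exp L / c * μ ^ n := by
    intro n x
    -- Somewhere in `[x, x + c]` the derivative of `f ^ n` equals the mean slope, which is at most
    -- `1 / c`. Passing from `ξ` to `x` costs at most `n log μ + L` in the logarithm: half of `n log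
    -- μ` comes from the modulus of continuity, half from `L n / q`.
    obtain ⟨ξ, hξ, hslope⟩ := exists_deriv_eq_slope (f ^ n : CircleDeg1Lift)
      (by linarith : x < x + c) (continuous_pow f hf.continuous n).continuousOn
      fun y _ => (hasDerivAt_pow hdiff n y).differentiableAt.differentiableWithinAt
    rw [(hasDerivAt_pow hdiff n ξ).deriv, add_sub_cancel_left] at hslope
    have hle1 : (f ^ n) (x + c) - (f ^ n) x ≤ 1 := by
      have := (f ^ n).monotone (by linarith : x + c ≤ x + 1)
      rw [map_add_one] at this
      linarith
    have hsum : ∑ j ∈ Finset.range n, φ ((f ^ j) x) - ∑ j ∈ Finset.range n, φ ((f ^ j) ξ) ≤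
        n * Real.log μ + L := by
      rw [← Finset.sum_sub_distrib]
      calc ∑ j ∈ Finset.range n, (φ ((f ^ j) x) - φ ((f ^ j) ξ))
          ≤ ∑ j ∈ Finset.range n,
              (Real.log μ / 2 + L * ((f ^ j) (x + c) - (f ^ j) x)) := by
            refine Finset.sum_le_sum fun j _ => (le_abs_self _).trans ((hφ _ _).trans ?_)
            have h₁ := (f ^ j).monotone hξ.1.le
            have h₂ := (f ^ j).monotone hξ.2.le
            gcongr
            rw [abs_le]
            constructor <;> linarith
        _ = n * (Real.log μ / 2) + L * ∑ j ∈ Finset.range n,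
              ((f ^ j) (x + c) - (f ^ j) x) := by
            rw [Finset.sum_add_distrib, ← Finset.mul_sum]
            simp
        _ ≤ n * (Real.log μ / 2) + L * (n / q + 1) := by
            gcongr
            exact sum_length_iterates_le hf.continuous hmono hq0 hc.le hc1 hcq x n
        _ ≤ n * Real.log μ + L := by
            have : L * (n / q) ≤ n * (Real.log μ / 2) := by
              rw [mul_div_assoc', div_le_iff₀ hq0']
              nlinarith [(Nat.cast_nonneg n : (0 : ℝ) ≤ n)]
            linarith
    have hμn : μ ^ n = Real.exp (n * Real.log μ) := by
      rw [Real.exp_nat_mul, Real.exp_log (by linarith)]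
    calc ∏ j ∈ Finset.range n, deriv f ((f ^ j) x)
        = Real.exp (∑ j ∈ Finset.range n, φ ((f ^ j) x)) := hexp n x
      _ ≤ Real.exp (∑ j ∈ Finset.range n, φ ((f ^ j) ξ) + (n * Real.log μ + L)) :=
          Real.exp_le_exp.2 (by linarith)
      _ = (((f ^ n) (x + c) - (f ^ n) x) / c) * (μ ^ n * Real.exp L) := by
          rw [Real.exp_add, Real.exp_add, ← hexp, hslope, hμn]
      _ ≤ 1 / c * (μ ^ n * Real.exp L) := by
          have : 0 < μ := by linarith
          gcongr
      _ = Real.exp L / c * μ ^ n := by ring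
  refine ⟨Real.exp L / c, by positivity, fun n u v => ?_⟩
  refine Convex.norm_image_sub_le_of_norm_deriv_le (𝕜 := ℝ) (s := Set.univ)
    (fun y _ => (hasDerivAt_pow hdiff n y).differentiableAt) (fun y _ => ?_) convex_univ
    (Set.mem_univ v) (Set.mem_univ u)
  rw [(hasDerivAt_pow hdiff n y).deriv, Real.norm_eq_abs,
    abs_of_nonneg (Finset.prod_nonneg fun j _ => (hpos _).le)]
  exact hderiv n y

end CircleDeg1Lift

/-! ### Ordering and distortion of lifted iterates -/

namespace CircleDeg1Lift

theorem deriv_pos_of_units {F : CircleDeg1Liftˣ} (hF : ContDiff ℝ 1 (F : CircleDeg1Lift))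
    (hF' : ContDiff ℝ 1 ((F⁻¹ : CircleDeg1Liftˣ) : CircleDeg1Lift)) (x : ℝ) :
    0 < deriv (F : CircleDeg1Lift) x := by
  have h₁ := ((hF'.differentiable one_ne_zero) ((F : CircleDeg1Lift) x)).hasDerivAt.comp x
    ((hF.differentiable one_ne_zero) x).hasDerivAt
  have h₂ : (((F⁻¹ : CircleDeg1Liftˣ) : CircleDeg1Lift) ∘ (F : CircleDeg1Lift) : ℝ → ℝ) = id :=
    funext fun y => units_inv_apply_apply F y
  rw [h₂] at h₁
  have h₃ := h₁.unique (hasDerivAt_id x)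
  refine lt_of_le_of_ne ((F : CircleDeg1Lift).monotone.deriv_nonneg) fun h0 => ?_
  rw [← h0, mul_zero] at h₃
  exact zero_ne_one h₃

/-- The lift `F ^ j + m` of the `j`-th iterate of the circle map with lift `F`. -/
def iterLift (F : CircleDeg1Liftˣ) (j m : ℤ) (x : ℝ) : ℝ :=
  ((F ^ j : CircleDeg1Liftˣ) : CircleDeg1Lift) x + m

variable {F : CircleDeg1Liftˣ}

theorem iterLift_comp (F : CircleDeg1Liftˣ) (j m k l : ℤ) (x : ℝ) :
    iterLift F j m (iterLift F k l x) = iterLift F (j + k) (m + l) x := by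
  simp only [iterLift, map_add_int, zpow_add, Units.val_mul, mul_apply, Int.cast_add]
  ring

theorem iterLift_zero (F : CircleDeg1Liftˣ) (x : ℝ) : iterLift F 0 0 x = x := by
  simp [iterLift]

theorem lt_iterLift {j m : ℤ} (h : 0 < j * (F : CircleDeg1Lift).translationNumber + m) (x : ℝ) :
    x < iterLift F j m x := by
  have := lt_map_of_int_lt_translationNumber ((F ^ j : CircleDeg1Liftˣ) : CircleDeg1Lift)
    (n := -m) (by rw [translationNumber_zpow]; push_cast; linarith) x
  push_cast at this
  rw [iterLift]
  linarith

/-- The maps `F ^ j + m` commute and are ordered by their translation numbers, so orbits of `F` have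
the order of orbits of the rotation. -/
theorem iterLift_lt_iterLift {j m k l : ℤ}
    (h : j * (F : CircleDeg1Lift).translationNumber + m <
      k * (F : CircleDeg1Lift).translationNumber + l) (x : ℝ) :
    iterLift F j m x < iterLift F k l x := by
  have := lt_iterLift (F := F) (j := k - j) (m := l - m) (by push_cast; linarith)
    (iterLift F j m x)
  rwa [iterLift_comp, sub_add_cancel, sub_add_cancel] at this

theorem iterLift_le_iterLift (hτ : Irrational (F : CircleDeg1Lift).translationNumber)
    {j m k l : ℤ} (h : j * (F : CircleDeg1Lift).translationNumber + m ≤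
      k * (F : CircleDeg1Lift).translationNumber + l) (x : ℝ) :
    iterLift F j m x ≤ iterLift F k l x := by
  rcases h.lt_or_eq with h | h
  · exact (iterLift_lt_iterLift h x).le
  · have hj := hτ.eq_zero_of_mul_add_eq_zero (j := j - k) (m := m - l) (by push_cast; linarith)
    obtain rfl : j = k := by omega
    obtain rfl : m = l := by exact_mod_cast add_left_cancel h
    exact le_rfl

theorem lt_of_iterLift_lt (hτ : Irrational (F : CircleDeg1Lift).translationNumber)
    {j m k l : ℤ} {x : ℝ} (h : iterLift F j m x < iterLift F k l x) :
    j * (F : CircleDeg1Lift).translationNumber + m <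
      k * (F : CircleDeg1Lift).translationNumber + l := by
  by_contra! hle
  exact h.not_ge (iterLift_le_iterLift hτ hle x)

theorem exists_abs_iterLift_sub_le (hF : ContDiff ℝ 1 (F : CircleDeg1Lift))
    (hF' : ContDiff ℝ 1 ((F⁻¹ : CircleDeg1Liftˣ) : CircleDeg1Lift))
    (hτ : Irrational (F : CircleDeg1Lift).translationNumber) {μ : ℝ} (hμ : 1 < μ) :
    ∃ C > 0, ∀ n : ℕ, ∀ j m : ℤ, |j| ≤ n → ∀ u v : ℝ,
      |iterLift F j m u - iterLift F j m v| ≤ C * μ ^ n * |u - v| := by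
  obtain ⟨C, hC, h⟩ := exists_abs_pow_sub_le hF (deriv_pos_of_units hF hF') hτ hμ
  obtain ⟨C', hC', h'⟩ := exists_abs_pow_sub_le hF' (deriv_pos_of_units hF' (by simpa using hF))
    (by rw [translationNumber_units_inv]; exact hτ.neg) hμ
  refine ⟨max C C', lt_max_of_lt_left hC, fun n j m hj u v => ?_⟩
  have hμ0 : 0 < μ := by linarith
  simp only [iterLift, add_sub_add_right_eq_sub]
  obtain ⟨i, rfl | rfl⟩ := Int.eq_nat_or_neg j
  · have hi : i ≤ n := by rw [Int.abs_natCast] at hj; omega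
    rw [zpow_natCast, Units.val_pow_eq_pow_val]
    refine (h i u v).trans ?_
    gcongr
    · exact le_max_left _ _
    · exact hμ.le
  · have hi : i ≤ n := by rw [abs_neg, Int.abs_natCast] at hj; omega
    rw [zpow_neg, ← inv_zpow, zpow_natCast, Units.val_pow_eq_pow_val]
    refine (h' i u v).trans ?_
    gcongr
    · exact le_max_right _ _
    · exact hμ.le

section Ratio

variable {j m k l : ℤ} {K : ℝ}

/-- If the left arc is the shorter one for the rotation, then the two arcs are comparable up to
the distortion of the first iterates. -/
theorem ratio_bounds_of_left_le (hτ : Irrational (F : CircleDeg1Lift).translationNumber)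
    (h₀ : j * (F : CircleDeg1Lift).translationNumber + m < 0)
    (h₁ : 0 ≤ (j * (F : CircleDeg1Lift).translationNumber + m) +
      (k * (F : CircleDeg1Lift).translationNumber + l))
    (h₂ : 2 * (j * (F : CircleDeg1Lift).translationNumber + m) +
      (k * (F : CircleDeg1Lift).translationNumber + l) ≤ 0)
    (hK : ∀ i i' : ℤ, |i| ≤ 2 * |j| → ∀ u v,
      |iterLift F i i' u - iterLift F i i' v| ≤ K * |u - v|) (T : ℝ) :
    T - iterLift F j m T ≤ 2 * K * (iterLift F k l T - T) ∧
      iterLift F k l T - T ≤ 2 * K * (T - iterLift F j m T) := by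
  have hj0 := abs_nonneg j
  have hg : iterLift F j m T < T := by
    have := iterLift_lt_iterLift (F := F) (j := j) (m := m) (k := 0) (l := 0)
      (by simpa using h₀) T
    rwa [iterLift_zero] at this
  have hh : T < iterLift F k l T := lt_iterLift (by linarith) T
  constructor
  -- With `g` and `h` the left and right maps, `T ≤ g (h T)` gives `T - g T ≤ g (h T) - g T`.
  · have h3 := iterLift_le_iterLift hτ (j := 0) (m := 0) (k := j + k) (l := m + l)
      (by push_cast; linarith) T
    rw [iterLift_zero, ← iterLift_comp] at h3
    have h4 := (le_abs_self _).trans (hK j m (by linarith) (iterLift F k l T) T)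
    rw [abs_of_pos (by linarith)] at h4
    nlinarith
  -- Here `h T ≤ g⁻² T`, and `[T, g⁻² T]` consists of the images of `[g T, T]` under `g⁻¹` and
  -- `g⁻²`.
  · have h3 := iterLift_le_iterLift hτ (j := k) (m := l) (k := -(2 * j)) (l := -(2 * m))
      (by push_cast; linarith) T
    have h4 := (le_abs_self _).trans (hK (-(2 * j)) (-(2 * m))
      (by rw [abs_neg, abs_mul]; simp) T (iterLift F j m T))
    have h5 := (le_abs_self _).trans (hK (-j) (-m) (by rw [abs_neg]; linarith) T
      (iterLift F j m T))
    rw [abs_of_pos (by linarith), iterLift_comp] at h4 h5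
    rw [neg_add_cancel, neg_add_cancel, iterLift_zero] at h5
    rw [show -(2 * j) + j = -j by ring, show -(2 * m) + m = -m by ring] at h4
    linarith

/-- If the right arc is the shorter one for the rotation, then the two arcs are comparable up to
the distortion of the first iterates. -/
theorem ratio_bounds_of_right_le (hτ : Irrational (F : CircleDeg1Lift).translationNumber)
    (h₀ : 0 < k * (F : CircleDeg1Lift).translationNumber + l)
    (h₁ : (j * (F : CircleDeg1Lift).translationNumber + m) +
      (k * (F : CircleDeg1Lift).translationNumber + l) ≤ 0)
    (h₂ : 0 ≤ (j * (F : CircleDeg1Lift).translationNumber + m) +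
      2 * (k * (F : CircleDeg1Lift).translationNumber + l))
    (hK : ∀ i i' : ℤ, |i| ≤ 2 * |k| → ∀ u v,
      |iterLift F i i' u - iterLift F i i' v| ≤ K * |u - v|) (T : ℝ) :
    T - iterLift F j m T ≤ 2 * K * (iterLift F k l T - T) ∧
      iterLift F k l T - T ≤ 2 * K * (T - iterLift F j m T) := by
  have hk0 := abs_nonneg k
  have hg : iterLift F j m T < T := by
    have := iterLift_lt_iterLift (F := F) (j := j) (m := m) (k := 0) (l := 0)
      (by push_cast; linarith) T
    rwa [iterLift_zero] at this
  have hh : T < iterLift F k l T := lt_iterLift h₀ T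
  constructor
  · have h3 := iterLift_le_iterLift hτ (j := -(2 * k)) (m := -(2 * l)) (k := j) (l := m)
      (by push_cast; linarith) T
    have h4 := (le_abs_self _).trans (hK (-(2 * k)) (-(2 * l))
      (by rw [abs_neg, abs_mul]; simp) (iterLift F k l T) T)
    have h5 := (le_abs_self _).trans (hK (-k) (-l) (by rw [abs_neg]; linarith)
      (iterLift F k l T) T)
    rw [abs_of_pos (by linarith), iterLift_comp] at h4 h5
    rw [neg_add_cancel, neg_add_cancel, iterLift_zero] at h5
    rw [show -(2 * k) + k = -k by ring, show -(2 * l) + l = -l by ring] at h4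
    linarith
  · have h3 := iterLift_le_iterLift hτ (j := k + j) (m := l + m) (k := 0) (l := 0)
      (by push_cast; linarith) T
    rw [iterLift_zero, ← iterLift_comp] at h3
    have h4 := (le_abs_self _).trans (hK k l (by linarith) T (iterLift F j m T))
    rw [abs_of_pos (by linarith)] at h4
    nlinarith

theorem div_mem_Icc_zpow {A B M lam : ℝ} {w : ℕ} (hA : 0 < A) (hB : 0 < B)
    (h₁ : A ≤ M * B) (h₂ : B ≤ M * A) (hlam : 0 < lam) (hM : M ≤ lam ^ w) :
    A / B ∈ Set.Icc (lam ^ (-(w : ℤ))) (lam ^ w) := by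
  rw [zpow_neg, zpow_natCast]
  refine ⟨?_, ?_⟩
  · rw [le_div_iff₀ hB, inv_mul_le_iff₀ (by positivity)]
    exact h₂.trans (by gcongr)
  · rw [div_le_iff₀ hB]
    exact h₁.trans (by gcongr)

end Ratio

/-! ### Initial and final ratios -/

variable {f : UnitAddCircle → UnitAddCircle}

theorem iterate_coe_eq_iterLift
    (hf : ∀ t : ℝ, f (t : UnitAddCircle) = (((F : CircleDeg1Lift) t : ℝ) : UnitAddCircle))
    (i : ℕ) (t : ℝ) (m : ℤ) :
    f^[i] (t : UnitAddCircle) = ((iterLift F i m t : ℝ) : UnitAddCircle) := by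
  rw [iterLift, UnitAddCircle.coe_add_intCast, zpow_natCast, Units.val_pow_eq_pow_val]
  induction i with
  | zero => simp
  | succ i ih => rw [Function.iterate_succ_apply', ih, hf, pow_succ', mul_apply]

theorem isBasicInterval_iterLift
    (hf : ∀ t : ℝ, f (t : UnitAddCircle) = (((F : CircleDeg1Lift) t : ℝ) : UnitAddCircle))
    (hτ : Irrational (F : CircleDeg1Lift).translationNumber) {n i il ir : ℕ} {j m k l : ℤ}
    (hi : i ≤ n) (hil : il ≤ n) (hir : ir ≤ n) (hj : (il : ℤ) = j + i) (hk : (ir : ℤ) = k + i)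
    (hg : j * (F : CircleDeg1Lift).translationNumber + m < 0)
    (hh : 0 < k * (F : CircleDeg1Lift).translationNumber + l)
    (hgh : (k * (F : CircleDeg1Lift).translationNumber + l) -
      (j * (F : CircleDeg1Lift).translationNumber + m) < 1)
    (honly : ∀ i' : ℕ, i' ≤ n → ∀ m' : ℤ,
      j * (F : CircleDeg1Lift).translationNumber + m <
        (i' - i) * (F : CircleDeg1Lift).translationNumber + m' →
      (i' - i) * (F : CircleDeg1Lift).translationNumber + m' <
        k * (F : CircleDeg1Lift).translationNumber + l → i' = i) (t : ℝ) :
    ∃ T : ℝ, IsBasicInterval (orbitSegment f n t) (f^[i] t) ((iterLift F j m T : ℝ))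
        ((iterLift F k l T : ℝ)) ∧
      arcLength (iterLift F j m T : ℝ) (f^[i] t) = T - iterLift F j m T ∧
      arcLength (f^[i] t) (iterLift F k l T : ℝ) = iterLift F k l T - T ∧
      iterLift F j m T < T ∧ T < iterLift F k l T := by
  have hT : f^[i] (t : UnitAddCircle) = ((iterLift F i 0 t : ℝ) : UnitAddCircle) :=
    iterate_coe_eq_iterLift hf i t 0
  have hgT : iterLift F j m (iterLift F i 0 t) = iterLift F il m t := by
    rw [iterLift_comp, hj, add_zero]
  have hhT : iterLift F k l (iterLift F i 0 t) = iterLift F ir l t := by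
    rw [iterLift_comp, hk, add_zero]
  have hj' : (il : ℝ) = j + i := by exact_mod_cast hj
  have hk' : (ir : ℝ) = k + i := by exact_mod_cast hk
  have h₁ : iterLift F il m t < iterLift F i 0 t :=
    iterLift_lt_iterLift (by push_cast; rw [hj']; linarith) t
  have h₂ : iterLift F i 0 t < iterLift F ir l t :=
    iterLift_lt_iterLift (by push_cast; rw [hk']; linarith) t
  have h₃ : iterLift F ir l t < iterLift F il m t + 1 := by
    have := iterLift_lt_iterLift (F := F) (j := ir) (m := l) (k := il) (l := m + 1)
      (by push_cast; rw [hj', hk']; linarith) t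
    refine this.trans_eq ?_
    simp only [iterLift]
    push_cast
    ring
  refine ⟨iterLift F i 0 t, ?_, ?_, ?_, ?_, ?_⟩
  · rw [hgT, hhT]
    refine ⟨⟨il, hil, (iterate_coe_eq_iterLift hf il t m).symm⟩,
      ⟨ir, hir, (iterate_coe_eq_iterLift hf ir t l).symm⟩, ?_⟩
    ext y
    rw [Set.mem_singleton_iff]
    constructor
    · rintro ⟨hy, i', hi', rfl⟩
      rw [iterate_coe_eq_iterLift hf i' t 0, coe_mem_cIoo_iff (h₁.trans h₂) h₃] at hy
      obtain ⟨m', hm₁, hm₂⟩ := hy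
      have he : iterLift F i' 0 t + m' = iterLift F i' m' t := by simp [iterLift]
      rw [he] at hm₁ hm₂
      have e₁ := lt_of_iterLift_lt hτ hm₁
      have e₂ := lt_of_iterLift_lt hτ hm₂
      push_cast at e₁ e₂
      rw [hj'] at e₁
      rw [hk'] at e₂
      rw [honly i' hi' m' (by linarith) (by linarith)]
    · rintro rfl
      refine ⟨?_, i, hi, rfl⟩
      rw [hT, coe_mem_cIoo_iff (h₁.trans h₂) h₃]
      exact ⟨0, by simpa using h₁, by simpa using h₂⟩
  · rw [hT, hgT]
    exact arcLength_coe_eq 0 (by simp) (by linarith) (by linarith)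
  · rw [hT, hhT]
    exact arcLength_coe_eq 0 (by simp) (by linarith) (by linarith)
  · rwa [hgT]
  · rwa [hhT]

/-- The initial and final ratios of the orbit segments of length `r + s - 2` are bounded by the
distortion of the iterates up to twice the time of the nearer neighbour. -/
theorem exists_ratios_mem_Icc
    (hf : ∀ t : ℝ, f (t : UnitAddCircle) = (((F : CircleDeg1Lift) t : ℝ) : UnitAddCircle))
    (hτ : Irrational (F : CircleDeg1Lift).translationNumber) {N r s w : ℕ} {a b K lam : ℝ}
    (hl : IsLeftNeighbour (F : CircleDeg1Lift).translationNumber N r a)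
    (hr : IsRightNeighbour (F : CircleDeg1Lift).translationNumber N s b)
    (hrs : r + s = N + 1) (hr2 : 2 ≤ r) (hs2 : 2 ≤ s) (hab1 : a + b < 1)
    (hab : a ≤ 2 * b) (hba : b ≤ 2 * a) (hlam : 0 < lam) (hw : 2 * K ≤ lam ^ w)
    (hK : ∀ i i' : ℤ, |i| ≤ 2 * (if a < b then r else s) → ∀ u v,
      |iterLift F i i' u - iterLift F i i' v| ≤ K * |u - v|) (x : UnitAddCircle) :
    ∃ ρ₀ ρ₁ : ℝ, IsInitialRatio f (N - 1) x ρ₀ ∧ IsFinalRatio f (N - 1) x ρ₁ ∧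
      ρ₀ ∈ Set.Icc (lam ^ (-(w : ℤ))) (lam ^ w) ∧ ρ₁ ∈ Set.Icc (lam ^ (-(w : ℤ))) (lam ^ w) := by
  induction x using QuotientAddGroup.induction_on with | H t => ?_
  obtain ⟨p, hp⟩ := hl.exists_eq
  obtain ⟨p', hp'⟩ := hr.exists_eq
  have ha := hl.pos
  have hb := hr.pos
  set τ := (F : CircleDeg1Lift).translationNumber with hτdef
  have honly : ∀ i : ℕ, i ≤ N → ∀ m : ℤ, -a < i * τ + m → i * τ + m < b → i = 0 := by
    intro i hi m h₁ h₂
    rcases lt_trichotomy (i * τ + m) 0 with h0 | h0 | h0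
    · exact absurd ⟨h₁, h0⟩ (hl.not_between i hi m)
    · have := hτ.eq_zero_of_mul_add_eq_zero (j := i) (m := m) (by exact_mod_cast h0)
      omega
    · exact absurd ⟨h0, h₂⟩ (hr.not_between i hi m)
  have hcast : ((N - 1 : ℕ) : ℝ) = N - 1 := by
    rw [Nat.cast_sub (hl.one_le.trans hl.le), Nat.cast_one]
  obtain ⟨T, hT, hT₁, hT₂, hT₃, hT₄⟩ := isBasicInterval_iterLift hf hτ (n := N - 1) (i := 0)
    (il := r) (ir := s) (j := r) (m := -p) (k := s) (l := -p') (by omega) (by omega) (by omega)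
    (by simp) (by simp) (by push_cast; linarith) (by push_cast; linarith)
    (by push_cast; linarith)
    (fun i' hi' m' h₁ h₂ => honly i' (by omega) m'
      (by push_cast at h₁; linarith) (by push_cast at h₂; linarith)) t
  -- Reversing time by `i' ↦ N - 1 - i'` swaps the sides: the neighbours of the last point are `s`
  -- steps back on the left and `r` steps back on the right, at times `N - 1 - s = r - 2` and `N - 1
  -- - r = s - 2`.
  obtain ⟨S, hS, hS₁, hS₂, hS₃, hS₄⟩ := isBasicInterval_iterLift hf hτ (n := N - 1)
    (i := N - 1) (il := r - 2) (ir := s - 2) (j := -s) (m := p') (k := -r) (l := p)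
    le_rfl (by omega) (by omega) (by omega) (by omega) (by push_cast; linarith)
    (by push_cast; linarith) (by push_cast; linarith)
    (fun i' hi' m' h₁ h₂ => by
      have hc : ((N - 1 - i' : ℕ) : ℝ) = N - 1 - i' := by rw [Nat.cast_sub hi', hcast]
      rw [hcast] at h₁ h₂
      push_cast at h₁ h₂
      have := honly (N - 1 - i') (by omega) (-m') (by rw [hc]; push_cast; linarith)
        (by rw [hc]; push_cast; linarith)
      omega) t
  refine ⟨_, _, ⟨_, _, hT, rfl⟩, ⟨_, _, hS, rfl⟩, ?_, ?_⟩
  · rw [Function.iterate_zero, id] at hT₁ hT₂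
    rw [hT₁, hT₂]
    obtain ⟨h₁, h₂⟩ : T - iterLift F r (-p) T ≤ 2 * K * (iterLift F s (-p') T - T) ∧
        iterLift F s (-p') T - T ≤ 2 * K * (T - iterLift F r (-p) T) := by
      split_ifs at hK with hlt
      · exact ratio_bounds_of_left_le hτ (by push_cast; linarith) (by push_cast; linarith)
          (by push_cast; linarith) (by simpa using hK) T
      · exact ratio_bounds_of_right_le hτ (by push_cast; linarith) (by push_cast; linarith)
          (by push_cast; linarith) (by simpa using hK) T
    exact div_mem_Icc_zpow (by linarith) (by linarith) h₁ h₂ hlam hw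
  · rw [hS₁, hS₂]
    obtain ⟨h₁, h₂⟩ : S - iterLift F (-s) p' S ≤ 2 * K * (iterLift F (-r) p S - S) ∧
        iterLift F (-r) p S - S ≤ 2 * K * (S - iterLift F (-s) p' S) := by
      split_ifs at hK with hlt
      · exact ratio_bounds_of_right_le hτ (by push_cast; linarith) (by push_cast; linarith)
          (by push_cast; linarith) (by simpa using hK) S
      · exact ratio_bounds_of_left_le hτ (by push_cast; linarith) (by push_cast; linarith)
          (by push_cast; linarith) (by simpa using hK) S
    exact div_mem_Icc_zpow (by linarith) (by linarith) h₁ h₂ hlam hw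

theorem exists_forall_ratios_mem_Icc
    (hf : ∀ t : ℝ, f (t : UnitAddCircle) = (((F : CircleDeg1Lift) t : ℝ) : UnitAddCircle))
    (hF : ContDiff ℝ 1 (F : CircleDeg1Lift))
    (hF' : ContDiff ℝ 1 ((F⁻¹ : CircleDeg1Liftˣ) : CircleDeg1Lift)) {τ : ℝ}
    (hFτ : (F : CircleDeg1Lift).translationNumber = τ) (hτ : Irrational τ) {lam : ℝ}
    (hlam : 1 < lam) :
    ∃ N₀, ∀ N, N₀ ≤ N → IsPreCharacteristic (τ : UnitAddCircle) N → ∀ x : UnitAddCircle,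
      ∃ ρ₀ ρ₁ : ℝ, IsInitialRatio f (N - 1) x ρ₀ ∧ IsFinalRatio f (N - 1) x ρ₁ ∧
        ρ₀ ∈ Set.Icc (lam ^ (-(wanderingTime (τ : UnitAddCircle) (N - 1) : ℤ)))
          (lam ^ wanderingTime (τ : UnitAddCircle) (N - 1)) ∧
        ρ₁ ∈ Set.Icc (lam ^ (-(wanderingTime (τ : UnitAddCircle) (N - 1) : ℤ)))
          (lam ^ wanderingTime (τ : UnitAddCircle) (N - 1)) := by
  subst hFτ
  -- The iterates used have order at most `4 min (r, s) ≤ 8 w + 16`. Of `lam ^ w = μ ^ (16 w)`, one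
  -- factor `μ ^ (8 w)` pays for their growth and the other absorbs `2 C μ ^ 16`.
  obtain ⟨μ, hμ, hμlam⟩ : ∃ μ : ℝ, 1 < μ ∧ μ ^ 16 = lam :=
    ⟨lam ^ ((16 : ℕ) : ℝ)⁻¹, Real.one_lt_rpow hlam (by positivity),
      Real.rpow_inv_natCast_pow (by linarith) (by norm_num)⟩
  obtain ⟨C, hC, hlip⟩ := exists_abs_iterLift_sub_le hF hF' hτ hμ
  obtain ⟨W, hW⟩ := pow_unbounded_of_one_lt (2 * C * μ ^ 16) hμ
  obtain ⟨N₀, hN₀⟩ := exists_forall_min_time_ge hτ (2 * W + 4)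
  refine ⟨N₀, fun N hN hpre x => ?_⟩
  obtain ⟨hl, hr⟩ := hpre.1.isNeighbour hτ
  obtain ⟨⟨hrs, hratio⟩, hcase⟩ := hpre
  rw [Set.mem_Icc, le_div_iff₀ hr.pos, div_le_iff₀ hr.pos] at hratio
  obtain ⟨hWr, hWs, hab1⟩ := hN₀ N hN _ _ _ _ hl hr (by linarith) (by linarith)
  have hmin := min_time_le_wanderingTime hτ hl hr hab1 hrs (by omega) (by omega)
  refine exists_ratios_mem_Icc hf hτ hl hr hrs (by omega) (by omega) hab1 (by linarith)
    (by linarith) (by linarith) ?_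
    (K := C * μ ^ (8 * wanderingTime ((F : CircleDeg1Lift).translationNumber : UnitAddCircle)
      (N - 1) + 16)) (fun i i' hi u v => hlip _ i i' ?_ u v) x
  · rw [← hμlam, ← pow_mul, pow_add]
    generalize wanderingTime _ (N - 1) = w at hmin
    calc 2 * (C * (μ ^ (8 * w) * μ ^ 16)) = 2 * C * μ ^ 16 * μ ^ (8 * w) := by ring
      _ ≤ μ ^ (8 * w) * μ ^ (8 * w) := by
          have : μ ^ W ≤ μ ^ (8 * w) := pow_le_pow_right₀ hμ.le (by omega)
          gcongr
          linarith
      _ = μ ^ (16 * w) := by rw [← pow_add]; congr 1; ring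
  · refine hi.trans ?_
    rcases hcase with ⟨h₁, h₂⟩ | ⟨h₁, h₂⟩
    · rw [if_pos h₁]
      omega
    · rw [if_neg h₁.not_gt]
      omega

end CircleDeg1Lift

theorem mainTheorem5 (α : ℝ) (hα : Irrational α) :
    (∃ k : ℕ → ℕ, IsCharacteristicSequence (α : UnitAddCircle) k) ∧
    ∀ k : ℕ → ℕ, IsCharacteristicSequence (α : UnitAddCircle) k →
      ∀ f ∈ FOne (α : UnitAddCircle), ∀ lam : ℝ, 1 < lam →
        ∃ i₀ : ℕ, ∀ i : ℕ, i₀ ≤ i → ∀ x : UnitAddCircle,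
          ∃ ρ₀ ρ₁ : ℝ, IsInitialRatio f (k i) x ρ₀ ∧ IsFinalRatio f (k i) x ρ₁ ∧
            ρ₀ ∈ Set.Icc (lam ^ (-(wanderingTime (α : UnitAddCircle) (k i) : ℤ)))
              (lam ^ wanderingTime (α : UnitAddCircle) (k i)) ∧
            ρ₁ ∈ Set.Icc (lam ^ (-(wanderingTime (α : UnitAddCircle) (k i) : ℤ)))
              (lam ^ wanderingTime (α : UnitAddCircle) (k i)) := by
  refine ⟨exists_isCharacteristicSequence hα, ?_⟩
  rintro k ⟨N, hN, hpre, hk⟩ f ⟨F, hF, hF', hf, hFα⟩ lam hlam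
  obtain ⟨m, hm⟩ := UnitAddCircle.coe_eq_coe_iff.1 hFα.symm
  have hτ : Irrational (F : CircleDeg1Lift).translationNumber := hm ▸ hα.add_intCast m
  -- Only the class of `α` modulo `ℤ` enters, so it can be represented by the translation number of
  -- the chosen lift.
  rw [← hFα] at hpre ⊢
  obtain ⟨N₀, hN₀⟩ := CircleDeg1Lift.exists_forall_ratios_mem_Icc hf hF hF' rfl hτ hlam
  refine ⟨N₀, fun i hi x => ?_⟩
  rw [hk]
  exact hN₀ (N i) (hi.trans (hN.le_apply)) (hpre i) x
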